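/- **Setting.** Let $E$ be a finite-dimensional real Euclidean space, let $x_a$ ($a=1,\dots,m$) and $y_b$ ($b=1,\dots,n$) be points of $E$, let $\kappa:E\times E\to\mathbb K$ ($\mathbb K=\mathbb R$ or $\mathbb C$) be a kernel and $A=[\kappa(x_a,y_b)]_{a,b}$. Let $\tau\in(0,1)$, $s>1$, $\epsilon_{\rm SVD}\ge 0$, $\epsilon_{\rm far}\ge 0$. Let $\mathcal T$ be a perfect binary tree with $L\ge1$ levels (root at level $1$, leaves at level $L$). Each node $i$ carries a bounded subdomain $\Omega_i\subset E$; the subdomains of the children of $i$ lie in $\Omega_i$, $\Omega_{\rm root}$ contains all points, and each given point of $\Omega_i$ lies in exactly one of the two children's subdomains. Let $\mathbf i^{row}$, $\mathbf i^{col}$ be the sets of indices of the points $x_a$, respectively $y_b$, in $\Omega_i$. Two sets with smallest enclosing balls of centres $a,b$ and radii $\delta_a,\delta_b>0$ are *well-separated* if $\delta_a+\delta_b\le\tau|a-b|$. For a node $i$, let $\mathcal N_i$ be the set of nodes $j\ne i$ at the level of $i$ such that $\Omega_i,\Omega_j$ are not well-separated. **HSS construction (SMASH).** For $l=L,L-1,\dots,2$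 and each node $i$ at level $l$, put $\bar{\mathbf i}^{row}=\mathbf i^{row}$ if $i$ is a leaf, $\bar{\mathbf i}^{row}=\hat{\mathbf c}_1^{row}\cup\hat{\mathbf c}_2^{row}$ if $i$ has children $c_1,c_2$, and likewise for $col$. * *Nearfield.* The block row $A_i^-=[A|_{\bar{\mathbf i}^{row}\times\bar{\mathbf j}^{col}}]_{j\in\mathcal N_i}$ is replaced by a truncated singular value decomposition $A_i^-=S_i\Sigma_i\widetilde S_i+E^-$ ($S_i$: leading left singular vectors) such that $\|E^-|_{\bar{\mathbf i}^{row}\times\bar{\mathbf j}^{col}}\|_F\le\sqrt{|\bar{\mathbf i}^{row}||\bar{\mathbf j}^{col}|}\,\epsilon_{\rm SVD}\|A_i^-\|_2$ for all $j\in\mathcal N_i$. * *Farfield.* There are basis matrices $\hat U_i$ (rows indexed by $\bar{\mathbf i}^{row}$) and $\hat V_i$ (rows indexed by $\bar{\mathbf i}^{col}$) such that, for all $i,j$ at the same level with $\Omega_i,\Omega_j$ well-separated, there is a matrix $\hat B_{i,j}$ with $\|A|_{\bar{\mathbf i}^{row}\times\bar{\mathbf j}^{col}}-\hat U_i\hat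 B_{i,j}\hat V_j^T\|_{\max}\le\epsilon_{\rm far}\|A|_{\mathbf i^{row}\times\mathbf j^{col}}\|_{\max}$. * *Compression.* Rows $\hat{\mathbf i}^{row}\subseteq\bar{\mathbf i}^{row}$ are selected such that $[\hat U_i,S_i]=P_i\begin{bmatrix}I\\G_i\end{bmatrix}[\hat U_i,S_i]|_{\hat{\mathbf i}^{row}}$, where $P_i$ is a permutation matrix, the identity block belongs to the selected rows, and all entries of $G_i$ have modulus at most $s$. * *Columns.* In the same way, with $A^T$ in place of $A$ and rows and columns exchanged, one gets left singular vectors $T_i$ of $[(A|_{\bar{\mathbf j}^{row}\times\bar{\mathbf i}^{col}})^T]_{j\in\mathcal N_i}$ truncated with the same tolerance, and $\hat{\mathbf i}^{col}\subseteq\bar{\mathbf i}^{col}$, $F_i$, $H_i$ with $[\hat V_i,T_i]=F_i\begin{bmatrix}I\\H_i\end{bmatrix}[\hat V_i,T_i]|_{\hat{\mathbf i}^{col}}$ and all entries of $H_i$ of modulus at most $s$. For $2\le l\le L$ let $U^{(l)}$, $V^{(l)}$ be the block diagonal matrices with blocks $P_i\begin{bmatrix}I\\G_i\end{bmatrix}$,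 respectively $F_i\begin{bmatrix}I\\H_i\end{bmatrix}$, over the nodes $i$ at level $l$. Let $B^{(L)}$ be block diagonal with blocks $A|_{\mathbf i^{row}\times\mathbf i^{col}}$ over the leaves $i$, and for $1\le l<L$ let $B^{(l)}$ be block diagonal with blocks $\begin{bmatrix}0&A|_{\hat{\mathbf c}_1^{row}\times\hat{\mathbf c}_2^{col}}\\A|_{\hat{\mathbf c}_2^{row}\times\hat{\mathbf c}_1^{col}}&0\end{bmatrix}$ over the nodes at level $l$, where $c_1,c_2$ are the children. The HSS approximation is $$\hat A=U^{(L)}\Big(U^{(L-1)}\big(\cdots(U^{(2)}B^{(1)}(V^{(2)})^T+B^{(2)})\cdots\big)(V^{(L-1)})^T+B^{(L-1)}\Big)(V^{(L)})^T+B^{(L)}$$ (so $\hat A=B^{(1)}=A$ if $L=1$). **Rank bounds.** Let $r^{(l)}$ be real constants with $|\hat{\mathbf i}^{row}|,|\hat{\mathbf i}^{col}|\le r^{(l)}$ for all nonroot nodes $i$ at level $l$, with $r^{(l+1)}\le r^{(l)}$ for $2\le l<L$, and with $|\mathbf i^{row}|,|\mathbf i^{col}|\le 2r^{(L)}$ for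 every leaf $i$. **Corollary 4.6.** If moreover there is a constant $r\ge2$ with $r^{(l)}\le r$ for each $1<l\le L$, then the approximation error $E=A-\hat A$ satisfies $$\|E\|_F\le(2r^2s^2)^L\,(16\,\epsilon_{\rm SVD}+8\,\epsilon_{\rm far})\,\|A\|_F .$$ -/

import Mathlib

open Matrix

noncomputable section

namespace SMASH

/-! ### Norms -/

/-- Frobenius norm. -/
def frobNorm {𝕜 α β : Type*} [RCLike 𝕜] [Fintype α] [Fintype β] (M : Matrix α β 𝕜) : ℝ :=
  Real.sqrt (∑ a, ∑ b, ‖M a b‖ ^ 2)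

/-- Spectral norm: the operator norm with respect to the Euclidean norms. -/
def specNorm {𝕜 α β : Type*} [RCLike 𝕜] [Fintype α] [Fintype β] [DecidableEq β]
    (M : Matrix α β 𝕜) : ℝ :=
  ‖LinearMap.toContinuousLinearMap (Matrix.toEuclideanLin M)‖

/-- Elementwise maximum norm (`0` for a matrix without entries). -/
def maxNorm {𝕜 α β : Type*} [RCLike 𝕜] (M : Matrix α β 𝕜) : ℝ :=
  ⨆ p : α × β, ‖M p.1 p.2‖

/-! ### Blocks -/

/-- The submatrix `A|_{I × J}`. -/
def block {𝕜 ι ι' : Type*} (A : Matrix ι ι' 𝕜) (I : Finset ι) (J : Finset ι') : Matrix I J 𝕜 :=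
  A.submatrix (fun a => (a : ι)) (fun b => (b : ι'))

open Classical in
/-- The block `A|_{I × J}` placed at its position in a matrix of full size, with zeros elsewhere. -/
def pad {𝕜 ι ι' : Type*} [Zero 𝕜] (I : Finset ι) (J : Finset ι') (A : Matrix ι ι' 𝕜) :
    Matrix ι ι' 𝕜 :=
  fun a b => if a ∈ I ∧ b ∈ J then A a b else 0

/-- The matrix `[κ(x, y)]` of a kernel on two finite families of points. -/
def kernelMatrix {𝕜 E m n : Type*} (κ : E → E → 𝕜) (x : m → E) (y : n → E) : Matrix m n 𝕜 :=
  fun a b => κ (x a) (y b)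

/-! ### Well-separated sets -/

/-- `a` is the centre and `δ` the radius of `S`: the ball around `a` of radius `δ` is the smallest
closed ball that contains `S`. -/
def IsCenterRadius {E : Type*} [MetricSpace E] (S : Set E) (a : E) (δ : ℝ) : Prop :=
  (∀ p ∈ S, dist p a ≤ δ) ∧ ∀ (c : E) (ρ : ℝ), (∀ p ∈ S, dist p c ≤ ρ) → δ ≤ ρ

/-- `S` and `T` are well-separated with separation ratio `τ`. -/
def WellSeparated {E : Type*} [MetricSpace E] (τ : ℝ) (S T : Set E) : Prop :=
  ∃ (a b : E) (δa δb : ℝ), IsCenterRadius S a δa ∧ IsCenterRadius T b δb ∧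
    0 < δa ∧ 0 < δb ∧ δa + δb ≤ τ * dist a b

/-! ### The perfect binary tree and the partitioning

The nodes of the perfect binary tree with `L` levels are the words `w` over `Bool` of length less
than `L`. The root is the empty word, the children of `w` are `false :: w` and `true :: w`, the
sibling of `b :: w` is `(!b) :: w`, and the level of `w` is `w.length + 1`. -/

/-- A hierarchical partitioning along the perfect binary tree with `L` levels: every node `w` has a
bounded subdomain `dom w`, the subdomains of the children lie in that of their parent, and each
point of the two families that lies in the subdomain of a parent lies in the subdomain of exactly
one child. The values of `dom` at words of length at least `L` play no role. -/
structure Partition {E m n : Type*} [MetricSpace E] (L : ℕ) (x : m → E) (y : n → E) where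
  dom : List Bool → Set E
  bounded_root : Bornology.IsBounded (dom [])
  row_root : ∀ a, x a ∈ dom []
  col_root : ∀ b, y b ∈ dom []
  child_subset : ∀ (w : List Bool) (c : Bool), w.length + 1 < L → dom (c :: w) ⊆ dom w
  row_child : ∀ (w : List Bool) (a : m), w.length + 1 < L → x a ∈ dom w →
    Xor (x a ∈ dom (false :: w)) (x a ∈ dom (true :: w))
  col_child : ∀ (w : List Bool) (b : n), w.length + 1 < L → y b ∈ dom w →
    Xor (y b ∈ dom (false :: w)) (y b ∈ dom (true :: w))

open Classical in
/-- The index set of the points of the family `x` that lie in the subdomain of `w`. -/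
def cluster {E ι : Type*} [Fintype ι] (dom : List Bool → Set E) (x : ι → E) (w : List Bool) :
    Finset ι :=
  Finset.univ.filter (fun a => x a ∈ dom w)

/-- The set `𝒩_w` of nearfield nodes of `w` in a perfect tree: the other nodes `v` at the level of
`w` whose subdomain is not well-separated from that of `w`. -/
def nearNodes {E : Type*} [MetricSpace E] (τ : ℝ) (dom : List Bool → Set E) (w : List Bool) :
    Set (List Bool) :=
  {v | v.length = w.length ∧ v ≠ w ∧ ¬ WellSeparated τ (dom w) (dom v)}

/-- The top-down description of the same nodes: a sibling that is not well-separated from `w`, or a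
child of a nearfield node of the parent that is not well-separated from `w`. -/
inductive NearRec {E : Type*} [MetricSpace E] (τ : ℝ) (dom : List Bool → Set E) :
    List Bool → List Bool → Prop
  | sibling (w : List Bool) (b : Bool) :
      ¬ WellSeparated τ (dom (b :: w)) (dom ((!b) :: w)) → NearRec τ dom (b :: w) ((!b) :: w)
  | child (w v : List Bool) (b c : Bool) : NearRec τ dom w v →
      ¬ WellSeparated τ (dom (b :: w)) (dom (c :: v)) → NearRec τ dom (b :: w) (c :: v)

/-- The two descriptions of the nearfield nodes agree when separation of two nodes passes on to
their children, as it does for instance when an interval is bisected repeatedly. -/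
theorem nearRec_iff {E : Type*} [MetricSpace E] (τ : ℝ) (dom : List Bool → Set E) (L : ℕ)
    (hered : ∀ (w v : List Bool) (b c : Bool), w.length = v.length → w.length + 1 < L →
      WellSeparated τ (dom w) (dom v) → WellSeparated τ (dom (b :: w)) (dom (c :: v)))
    (w v : List Bool) (hw : w.length < L) :
    NearRec τ dom w v ↔ v ∈ nearNodes τ dom w := by
  constructor
  · intro h
    clear hw
    induction h with
    | sibling w b h => exact ⟨by simp, by simp, h⟩
    | child w v b c _ h ih =>
      obtain ⟨h1, h2, _⟩ := ih
      exact ⟨by simpa using h1, fun e => h2 (List.cons.inj e).2, h⟩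
  · rintro ⟨h1, h2, h3⟩
    induction w generalizing v with
    | nil => exact absurd (List.length_eq_zero_iff.1 h1) h2
    | cons b w ih =>
      cases v with
      | nil => simp at h1
      | cons c v =>
        have hl : v.length = w.length := by simpa using h1
        by_cases e : v = w
        · subst e
          have hc : c = !b := by
            cases b <;> cases c <;> simp_all
          subst hc
          exact NearRec.sibling _ _ h3
        · have hw' : w.length + 1 < L := by simpa using hw
          refine NearRec.child _ _ _ _ (ih v (by omega) hl e ?_) h3
          exact fun hs => h3 (hered w v b c hl.symm hw' hs)

/-! ### Truncated singular value decomposition -/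

/-- `M = S * diag σ * W` is a (thin) singular value decomposition: the columns of `S` and the rows
of `W` are orthonormal, and the singular values are nonnegative and in decreasing order. -/
def IsSVD {𝕜 α β : Type*} [RCLike 𝕜] [Fintype α] [Fintype β] {ρ : ℕ} (M : Matrix α β 𝕜)
    (S : Matrix α (Fin ρ) 𝕜) (σ : Fin ρ → ℝ) (W : Matrix (Fin ρ) β 𝕜) : Prop :=
  Sᴴ * S = 1 ∧ W * Wᴴ = 1 ∧ Antitone σ ∧ (∀ t, 0 ≤ σ t) ∧
    M = S * Matrix.diagonal (fun t => (σ t : 𝕜)) * W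

/-- `S`, `σ`, `W` consist of the `k` leading singular vectors and values of `M`. -/
def IsTruncatedSVD {𝕜 α β : Type*} [RCLike 𝕜] [Fintype α] [Fintype β] {k : ℕ} (M : Matrix α β 𝕜)
    (S : Matrix α (Fin k) 𝕜) (σ : Fin k → ℝ) (W : Matrix (Fin k) β 𝕜) : Prop :=
  ∃ (ρ : ℕ) (h : k ≤ ρ) (S₀ : Matrix α (Fin ρ) 𝕜) (σ₀ : Fin ρ → ℝ) (W₀ : Matrix (Fin ρ) β 𝕜),
    IsSVD M S₀ σ₀ W₀ ∧ S = S₀.submatrix id (Fin.castLE h) ∧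
      σ = σ₀ ∘ Fin.castLE h ∧ W = W₀.submatrix (Fin.castLE h) id

/-! ### Compression of a basis by row selection -/

open Classical in
/-- The matrix `P [I; G]` with rows `bar` and columns `hat ⊆ bar`, placed at its position in a
matrix of full size: its rows in `hat` form the identity matrix, its rows in `bar \ hat` form `G`.
Rows and columns carry the indices of the points, so that no permutation `P` has to be written. -/
def interp {𝕜 ι : Type*} [Zero 𝕜] [One 𝕜] (bar hat : Finset ι) (G : Matrix ι ι 𝕜) :
    Matrix ι ι 𝕜 :=
  fun a c => if a ∈ bar ∧ c ∈ hat then (if a ∈ hat then (if a = c then 1 else 0) else G a c) else 0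

/-- `[P, G, hat] = compr(C, bar)`: the rows `hat` are selected from the rows `bar` of `C`, the
factorization `C = P [I; G] C|_hat` holds, and the entries of `G` are at most `s` in modulus.
It is not required that the number of selected rows be the rank of `C`. -/
structure IsCompr {𝕜 ι γ : Type*} [RCLike 𝕜] (s : ℝ) (bar hat : Finset ι) (C : Matrix bar γ 𝕜)
    (G : Matrix ι ι 𝕜) : Prop where
  subset : hat ⊆ bar
  bound : ∀ a ∈ bar, a ∉ hat → ∀ c ∈ hat, ‖G a c‖ ≤ s
  factor : C = block (interp bar hat G) bar hat *
    C.submatrix (fun c : hat => (⟨c, subset c.2⟩ : bar)) id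

/-! ### The HSS construction -/

/-- What the construction chooses on one side (rows or columns), node by node: the selected index
set `hat w`, the matrix `G w` of the compression, and the farfield basis `far w`, which has
`farRank w` columns. -/
structure BasisData (𝕜 ι : Type*) where
  hat : List Bool → Finset ι
  G : List Bool → Matrix ι ι 𝕜
  farRank : List Bool → ℕ
  far : ∀ w, Matrix ι (Fin (farRank w)) 𝕜

open Classical in
/-- The intermediate index set of `w`: all points of the node if `w` is a leaf, the union of the
sets that were selected at the two children otherwise. -/
def bar {ι : Type*} (L : ℕ) (full hat : List Bool → Finset ι) (w : List Bool) : Finset ι :=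
  if w.length + 1 = L then full w else hat (false :: w) ∪ hat (true :: w)

open Classical in
/-- The union of the index sets `J v` over the nodes `v ∈ N`. -/
def unionOver {ι : Type*} [Fintype ι] (N : Set (List Bool)) (J : List Bool → Finset ι) :
    Finset ι :=
  Finset.univ.filter (fun b => ∃ v ∈ N, b ∈ J v)

open Classical in
/-- One side of the construction at the node `w`. Here `I` is the intermediate index set of `w`,
`J` gives the intermediate index sets of the other side, and `N` is the set of nearfield nodes
of `w`. The nearfield block row `A|_{I × ∪ J v}` is approximated by a truncated singular value
decomposition with relative tolerance `εSVD`, and the left singular vectors that are kept are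
compressed together with the farfield basis. -/
def NodeStep {𝕜 ι ι' : Type*} [RCLike 𝕜] [Fintype ι] [Fintype ι'] (s εSVD : ℝ) (A : Matrix ι ι' 𝕜)
    (N : Set (List Bool)) (I : Finset ι) (J : List Bool → Finset ι') (D : BasisData 𝕜 ι)
    (w : List Bool) : Prop :=
  ∃ (k : ℕ) (S : Matrix I (Fin k) 𝕜) (σ : Fin k → ℝ) (W : Matrix (Fin k) (unionOver N J) 𝕜),
    IsTruncatedSVD (block A I (unionOver N J)) S σ W ∧
    (∀ v ∈ N,
      frobNorm ((block A I (unionOver N J) - S * Matrix.diagonal (fun t => (σ t : 𝕜)) * W).submatrix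
          id (fun b : {b : unionOver N J // (b : ι') ∈ J v} => b.1))
        ≤ Real.sqrt ((I.card : ℝ) * ((J v).card : ℝ)) * εSVD *
            specNorm (block A I (unionOver N J))) ∧
    IsCompr s I (D.hat w)
      (Matrix.fromCols ((D.far w).submatrix (fun a : I => (a : ι)) id) S) (D.G w)

/-- `R` (rows) and `C` (columns) result from the SMASH construction of an HSS approximation to
`A = [κ(x, y)]` over the given partitioning, with separation ratio `τ`, bound `s` in the
compressions, and tolerances `εSVD` (nearfield) and `εfar` (farfield). -/
structure IsSMASH {𝕜 E m n : Type*} [RCLike 𝕜] [MetricSpace E] [Fintype m] [Fintype n] {L : ℕ}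
    {x : m → E} {y : n → E} (κ : E → E → 𝕜) (T : Partition L x y) (τ s εSVD εfar : ℝ)
    (R : BasisData 𝕜 m) (C : BasisData 𝕜 n) : Prop where
  row_step : ∀ w : List Bool, w ≠ [] → w.length < L →
    NodeStep s εSVD (kernelMatrix κ x y) (nearNodes τ T.dom w)
      (bar L (cluster T.dom x) R.hat w) (bar L (cluster T.dom y) C.hat) R w
  col_step : ∀ w : List Bool, w ≠ [] → w.length < L →
    NodeStep s εSVD (kernelMatrix κ x y)ᵀ (nearNodes τ T.dom w)
      (bar L (cluster T.dom y) C.hat w) (bar L (cluster T.dom x) R.hat) C w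
  /-- The farfield bases provide, for well-separated nodes at the same level, a degenerate
  approximation whose entrywise error is at most `εfar` times the largest entry of the block. -/
  farfield : ∀ w v : List Bool, w ≠ [] → w.length < L → v.length = w.length →
    WellSeparated τ (T.dom w) (T.dom v) →
    ∃ B : Matrix (Fin (R.farRank w)) (Fin (C.farRank v)) 𝕜,
      ∀ a ∈ bar L (cluster T.dom x) R.hat w, ∀ b ∈ bar L (cluster T.dom y) C.hat v,
        ‖kernelMatrix κ x y a b - (R.far w * B * (C.far v)ᵀ) a b‖
          ≤ εfar * maxNorm (block (kernelMatrix κ x y) (cluster T.dom x w) (cluster T.dom y v))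

/-! ### The telescoping representation

All factors are written as matrices of full size, with zero rows and columns outside the index sets
that the level uses. -/

/-- The block diagonal matrix `U^(l)` (or `V^(l)`) of the bases, respectively transfer matrices, of
the nodes at level `l`. -/
def levelBasis {𝕜 ι : Type*} [RCLike 𝕜] [Fintype ι] (L : ℕ) (full : List Bool → Finset ι)
    (D : BasisData 𝕜 ι) (l : ℕ) : Matrix ι ι 𝕜 :=
  ∑ w : List.Vector Bool (l - 1), interp (bar L full D.hat w.1) (D.hat w.1) (D.G w.1)

/-- The block diagonal matrix `B^(l)`: the diagonal blocks of `A` at the leaves for `l = L`, and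
the coupling matrices of the pairs of siblings whose parent is at level `l` for `l < L`. -/
def levelCoupling {𝕜 m n : Type*} [RCLike 𝕜] (L : ℕ) (A : Matrix m n 𝕜)
    (rowFull : List Bool → Finset m) (colFull : List Bool → Finset n)
    (R : BasisData 𝕜 m) (C : BasisData 𝕜 n) (l : ℕ) : Matrix m n 𝕜 :=
  if l = L then ∑ w : List.Vector Bool (l - 1), pad (rowFull w.1) (colFull w.1) A
  else ∑ w : List.Vector Bool (l - 1), ∑ c : Bool,
    pad (R.hat (c :: w.1)) (C.hat ((!c) :: w.1)) A

/-- The nested expression `U^(l) (U^(l-1) (⋯) (V^(l-1))ᵀ + B^(l-1)) (V^(l))ᵀ + B^(l)`, whose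
innermost term is `B^(1)`. -/
def telescope {𝕜 m n : Type*} [RCLike 𝕜] [Fintype m] [Fintype n] (U : ℕ → Matrix m m 𝕜)
    (V : ℕ → Matrix n n 𝕜) (B : ℕ → Matrix m n 𝕜) : ℕ → Matrix m n 𝕜
  | 0 => 0
  | 1 => B 1
  | l + 2 => U (l + 2) * telescope U V B (l + 1) * (V (l + 2))ᵀ + B (l + 2)

/-- The HSS approximation of `A = [κ(x, y)]`. -/
def hssApprox {𝕜 E m n : Type*} [RCLike 𝕜] [MetricSpace E] [Fintype m] [Fintype n] {L : ℕ}
    {x : m → E} {y : n → E} (κ : E → E → 𝕜) (T : Partition L x y)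
    (R : BasisData 𝕜 m) (C : BasisData 𝕜 n) : Matrix m n 𝕜 :=
  telescope (levelBasis L (cluster T.dom x) R) (levelBasis L (cluster T.dom y) C)
    (levelCoupling L (kernelMatrix κ x y) (cluster T.dom x) (cluster T.dom y) R C) L

end SMASH

end

/-!
The error analysis of the SMASH construction of an HSS approximation.

For `l = k + 1` let `Y l` be `B l` together with the off-diagonal blocks `A|_{bar w × bar v}`,
`w ≠ v`, of the nodes at level `l`. At the leaves `Y L = A`, and since the intermediate index set of
an inner node is the disjoint union of the selected sets of its children, `Y l` consists of the
blocks `A|_{hat w × hat v}`, `w ≠ v`, of the level below. Hence `residual`, the difference of `Y l`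
and the telescoping expression up to level `l`, obeys a recursion over the levels
(`residual_succ`): it is the error of replacing every `A|_{bar w × bar v}` by
`P_w A|_{hat w × hat v} P_vᵀ`, where `P_w = P [I; G]` is the interpolation matrix of `w`, plus
`U l * residual * (V l)ᵀ` with the residual of the level above.

With at most `2r` rows and entries of `G` at most `s`, the matrix `P_w` has spectral norm at most
`q = √(1 + r²s²)` (`frobNorm_interp_mul_le`), and so have the block diagonal matrices `U l`, `V l`.
The interpolation is exact on the span of the compressed basis (`IsCompr.interp_mul`). A nearfield
block therefore loses only the truncation errors of its row and of its column
(`NodeStep.near_error`), and a farfield block only the error of the degenerate approximation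
(`far_error`), each up to powers of `q`. Summing squares over the blocks of a level, which have
disjoint supports, gives
`2r ((1 + q)² √(2^k) εSVD + (1 + q²) εfar) ‖A‖_F` for the level (`frobNorm_offDiag_sub_le`).
As `r ≥ 2` and `s > 1`, both `q²` and these level errors are small enough for the bound
`(2r²s²)^l (16 εSVD + 8 εfar) ‖A‖_F` to propagate from level to level (`frobNorm_residual_le`).
-/

open Matrix

noncomputable section

namespace SMASH

/-! ### The Frobenius norm -/

section Frobenius

variable {𝕜 α β γ : Type*} [RCLike 𝕜] [Fintype α] [Fintype β] [Fintype γ]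

theorem frobNorm_nonneg (M : Matrix α β 𝕜) : 0 ≤ frobNorm M := Real.sqrt_nonneg _

theorem frobNorm_sq (M : Matrix α β 𝕜) : frobNorm M ^ 2 = ∑ a, ∑ b, ‖M a b‖ ^ 2 :=
  Real.sq_sqrt (by positivity)

theorem frobNorm_zero : frobNorm (0 : Matrix α β 𝕜) = 0 := by
  simp [frobNorm]

theorem frobNorm_transpose (M : Matrix α β 𝕜) : frobNorm Mᵀ = frobNorm M := by
  unfold frobNorm
  rw [Finset.sum_comm]
  rfl

theorem frobNorm_le_of_entry_le {M N : Matrix α β 𝕜} (h : ∀ a b, ‖M a b‖ ≤ ‖N a b‖) :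
    frobNorm M ≤ frobNorm N := by
  refine Real.sqrt_le_sqrt (Finset.sum_le_sum fun a _ => Finset.sum_le_sum fun b _ => ?_)
  gcongr
  exact h a b

theorem norm_entry_le_frobNorm (M : Matrix α β 𝕜) (a : α) (b : β) : ‖M a b‖ ≤ frobNorm M := by
  refine abs_le_of_sq_le_sq' ?_ (frobNorm_nonneg M) |>.2
  rw [frobNorm_sq]
  calc ‖M a b‖ ^ 2 ≤ ∑ b, ‖M a b‖ ^ 2 :=
        Finset.single_le_sum (f := fun b => ‖M a b‖ ^ 2) (fun _ _ => by positivity)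
          (Finset.mem_univ b)
    _ ≤ _ := Finset.single_le_sum (f := fun a => ∑ b, ‖M a b‖ ^ 2) (fun _ _ => by positivity)
          (Finset.mem_univ a)

theorem frobNorm_neg (M : Matrix α β 𝕜) : frobNorm (-M) = frobNorm M := by
  simp [frobNorm]

section

attribute [local instance] Matrix.frobeniusNormedAddCommGroup

theorem frobNorm_add_le (M N : Matrix α β 𝕜) : frobNorm (M + N) ≤ frobNorm M + frobNorm N := by
  have key : ∀ X : Matrix α β 𝕜, frobNorm X = ‖X‖ := fun X => by
    rw [Matrix.frobenius_norm_def, frobNorm, Real.sqrt_eq_rpow]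
    simp
  simpa only [key] using norm_add_le M N

end

theorem frobNorm_sub_le (M N : Matrix α β 𝕜) : frobNorm (M - N) ≤ frobNorm M + frobNorm N := by
  rw [sub_eq_add_neg, ← frobNorm_neg N]
  exact frobNorm_add_le _ _

theorem specNorm_le_frobNorm [DecidableEq β] (M : Matrix α β 𝕜) : specNorm M ≤ frobNorm M := by
  refine ContinuousLinearMap.opNorm_le_bound _ (frobNorm_nonneg M) fun v => ?_
  refine abs_le_of_sq_le_sq' ?_ (mul_nonneg (frobNorm_nonneg M) (norm_nonneg v)) |>.2
  rw [mul_pow, frobNorm_sq, EuclideanSpace.norm_sq_eq, EuclideanSpace.norm_sq_eq,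
    Finset.sum_mul]
  refine Finset.sum_le_sum fun a _ => ?_
  have h : (LinearMap.toContinuousLinearMap (Matrix.toEuclideanLin M) v) a
      = ∑ b, M a b * v b := rfl
  rw [h]
  calc ‖∑ b, M a b * v b‖ ^ 2 ≤ (∑ b, ‖M a b‖ * ‖v b‖) ^ 2 := by
        gcongr
        exact (norm_sum_le _ _).trans_eq (Finset.sum_congr rfl fun b _ => norm_mul _ _)
    _ ≤ _ := Finset.sum_mul_sq_le_sq_mul_sq _ _ _

/-- Pythagoras for matrices whose supports are pairwise disjoint. -/
theorem frobNorm_sum_sq {P : Type*} [Fintype P] (M : P → Matrix α β 𝕜)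
    (h : ∀ p p' a b, M p a b ≠ 0 → M p' a b ≠ 0 → p = p') :
    frobNorm (∑ p, M p) ^ 2 = ∑ p, frobNorm (M p) ^ 2 := by
  simp_rw [frobNorm_sq]
  conv_rhs => rw [Finset.sum_comm]
  refine Finset.sum_congr rfl fun a _ => ?_
  conv_rhs => rw [Finset.sum_comm]
  refine Finset.sum_congr rfl fun b _ => ?_
  rw [Matrix.sum_apply]
  by_cases hp : ∃ p, M p a b ≠ 0
  · obtain ⟨p, hp⟩ := hp
    have h0 : ∀ p' ∈ Finset.univ, p' ≠ p → M p' a b = 0 := fun p' _ hne => by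
      by_contra hc
      exact hne (h _ _ _ _ hc hp)
    rw [Finset.sum_eq_single p h0 (by simp), Finset.sum_eq_single p _ (by simp)]
    intro p' hp' hne
    simp [h0 p' hp' hne]
  · push Not at hp
    simp [hp]

end Frobenius

/-! ### Coordinate projections -/

section Projections

variable {𝕜 ι ι' : Type*} [RCLike 𝕜]

open Classical in
/-- The coordinate projection onto the index set `I`. -/
def proj (𝕜 : Type*) [RCLike 𝕜] {ι : Type*} (I : Finset ι) : Matrix ι ι 𝕜 :=
  Matrix.diagonal fun a => if a ∈ I then 1 else 0

theorem proj_transpose (I : Finset ι) : (proj 𝕜 I)ᵀ = proj 𝕜 I := by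
  simp [proj]

open Classical in
theorem proj_mul_apply [Fintype ι] (I : Finset ι) (M : Matrix ι ι' 𝕜) (a : ι) (b : ι') :
    (proj 𝕜 I * M) a b = if a ∈ I then M a b else 0 := by
  simp [proj, Matrix.diagonal_mul]

open Classical in
theorem mul_proj_apply [Fintype ι'] (J : Finset ι') (M : Matrix ι ι' 𝕜) (a : ι) (b : ι') :
    (M * proj 𝕜 J) a b = if b ∈ J then M a b else 0 := by
  simp [proj, Matrix.mul_diagonal]

theorem proj_mul_proj_of_subset [Fintype ι] {H I : Finset ι} (h : H ⊆ I) :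
    proj 𝕜 H * proj 𝕜 I = proj 𝕜 H := by
  classical
  ext a b
  rw [mul_proj_apply]
  by_cases hb : b ∈ I
  · simp [hb]
  · have : b ∉ H := fun hc => hb (h hc)
    simp only [hb, if_false, proj, Matrix.diagonal_apply]
    split_ifs with h1 h2 <;> simp_all

theorem pad_eq_proj [Fintype ι] [Fintype ι'] (I : Finset ι) (J : Finset ι') (A : Matrix ι ι' 𝕜) :
    pad I J A = proj 𝕜 I * A * proj 𝕜 J := by
  classical
  ext a b
  rw [mul_proj_apply, proj_mul_apply, pad]
  split_ifs <;> simp_all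

open Classical in
theorem proj_union {I J : Finset ι} (h : ∀ a, a ∈ I → a ∈ J → False) :
    proj 𝕜 (I ∪ J) = proj 𝕜 I + proj 𝕜 J := by
  rw [proj, proj, proj, Matrix.diagonal_add]
  congr 1
  ext a
  have := h a
  by_cases h1 : a ∈ I <;> by_cases h2 : a ∈ J <;> simp_all

variable [Fintype ι] [Fintype ι']

theorem frobNorm_proj_mul_le (I : Finset ι) (M : Matrix ι ι' 𝕜) :
    frobNorm (proj 𝕜 I * M) ≤ frobNorm M := by
  refine frobNorm_le_of_entry_le fun a b => ?_
  rw [proj_mul_apply]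
  split_ifs <;> simp

theorem frobNorm_mul_proj_le (J : Finset ι') (M : Matrix ι ι' 𝕜) :
    frobNorm (M * proj 𝕜 J) ≤ frobNorm M := by
  refine frobNorm_le_of_entry_le fun a b => ?_
  rw [mul_proj_apply]
  split_ifs <;> simp

theorem frobNorm_proj_mul_le_of_subset {H I : Finset ι} (h : H ⊆ I) (M : Matrix ι ι' 𝕜) :
    frobNorm (proj 𝕜 H * M) ≤ frobNorm (proj 𝕜 I * M) := by
  rw [← proj_mul_proj_of_subset h, Matrix.mul_assoc]
  exact frobNorm_proj_mul_le _ _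

/-- The squared norms of the blocks of rows over pairwise disjoint index sets add up to at most the
squared norm of the matrix. -/
theorem sum_frobNorm_proj_mul_sq_le {P : Type*} [Fintype P] (I : P → Finset ι)
    (hI : ∀ p p' a, a ∈ I p → a ∈ I p' → p = p') (M : Matrix ι ι' 𝕜) :
    ∑ p, frobNorm (proj 𝕜 (I p) * M) ^ 2 ≤ frobNorm M ^ 2 := by
  classical
  rw [← frobNorm_sum_sq]
  · refine pow_le_pow_left₀ (frobNorm_nonneg _) (frobNorm_le_of_entry_le fun a b => ?_) 2
    simp_rw [Matrix.sum_apply, proj_mul_apply]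
    by_cases hp : ∃ p, a ∈ I p
    · obtain ⟨p, hp⟩ := hp
      rw [Finset.sum_eq_single p (fun p' _ hne => if_neg fun hc => hne (hI _ _ _ hc hp))
        (by simp), if_pos hp]
    · push Not at hp
      simp [hp]
  · intro p p' a b h h'
    simp only [proj_mul_apply, ne_eq, ite_eq_right_iff, Classical.not_imp] at h h'
    exact hI _ _ _ h.1 h'.1

/-- The Frobenius norm of a submatrix is that of the matrix padded with zeros. -/
theorem frobNorm_block (I : Finset ι) (J : Finset ι') (M : Matrix ι ι' 𝕜) :
    frobNorm (block M I J) = frobNorm (proj 𝕜 I * M * proj 𝕜 J) := by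
  classical
  unfold frobNorm
  congr 1
  have h : ∀ a b, ‖(proj 𝕜 I * M * proj 𝕜 J) a b‖ ^ 2
      = if a ∈ I then (if b ∈ J then ‖M a b‖ ^ 2 else 0) else 0 := fun a b => by
    rw [mul_proj_apply, proj_mul_apply]
    split_ifs <;> simp
  simp_rw [h]
  have h2 : ∀ a, (∑ b, if a ∈ I then (if b ∈ J then ‖M a b‖ ^ 2 else 0) else 0)
      = if a ∈ I then ∑ b ∈ J, ‖M a b‖ ^ 2 else 0 := fun a => by
    split_ifs <;> simp [Finset.sum_ite_mem]
  simp_rw [h2, Finset.sum_ite_mem, Finset.univ_inter]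
  rw [← Finset.sum_coe_sort I]
  refine Finset.sum_congr rfl fun a _ => ?_
  rw [← Finset.sum_coe_sort J]
  rfl

theorem maxNorm_block_le (I : Finset ι) (J : Finset ι') (M : Matrix ι ι' 𝕜) :
    maxNorm (block M I J) ≤ frobNorm (proj 𝕜 I * M * proj 𝕜 J) := by
  rw [← frobNorm_block]
  exact Real.iSup_le (fun p => norm_entry_le_frobNorm _ _ _) (frobNorm_nonneg _)

theorem frobNorm_proj_mul_proj_le (I : Finset ι) (J : Finset ι') (M : Matrix ι ι' 𝕜) {c : ℝ}
    (hc : 0 ≤ c) (h : ∀ a ∈ I, ∀ b ∈ J, ‖M a b‖ ≤ c) :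
    frobNorm (proj 𝕜 I * M * proj 𝕜 J) ≤ Real.sqrt ((I.card : ℝ) * J.card) * c := by
  rw [← frobNorm_block]
  unfold frobNorm
  rw [Real.sqrt_le_left (by positivity), mul_pow, Real.sq_sqrt (by positivity)]
  calc ∑ a, ∑ b, ‖block M I J a b‖ ^ 2 ≤ ∑ _a : I, ∑ _b : J, c ^ 2 := by
        gcongr with a _ b _
        exact h a a.2 b b.2
    _ = _ := by simp [mul_assoc]

end Projections

/-! ### Interpolation from selected rows -/

section Interpolation

variable {𝕜 ι ι' δ : Type*} [RCLike 𝕜] [Fintype ι] [Fintype ι']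

/-- The bound `√(1 + r²s²)` for the spectral norm of `P [I; G]` when it has at most `2r` rows. -/
def interpBound (r s : ℝ) : ℝ := Real.sqrt (1 + r ^ 2 * s ^ 2)

theorem interpBound_nonneg (r s : ℝ) : 0 ≤ interpBound r s := Real.sqrt_nonneg _

theorem interpBound_sq (r s : ℝ) : interpBound r s ^ 2 = 1 + r ^ 2 * s ^ 2 :=
  Real.sq_sqrt (by positivity)

theorem proj_mul_interp (I H : Finset ι) (G : Matrix ι ι 𝕜) :
    proj 𝕜 I * interp I H G = interp I H G := by
  classical
  ext a b
  rw [proj_mul_apply, interp]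
  split_ifs <;> simp_all

theorem interp_mul_proj (I H : Finset ι) (G : Matrix ι ι 𝕜) :
    interp I H G * proj 𝕜 H = interp I H G := by
  classical
  ext a b
  rw [mul_proj_apply, interp]
  split_ifs <;> simp_all

open Classical in
theorem interp_mul_apply {I H : Finset ι} (hHI : H ⊆ I) (G : Matrix ι ι 𝕜) (X : Matrix ι δ 𝕜)
    (a : ι) (b : δ) :
    (interp I H G * X) a b =
      if a ∈ H then X a b else if a ∈ I then ∑ c ∈ H, G a c * X c b else 0 := by
  rw [Matrix.mul_apply]
  simp only [interp]
  by_cases hH : a ∈ H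
  · have hI := hHI hH
    rw [if_pos hH, Finset.sum_eq_single a]
    · simp [hH, hI]
    · intro c _ hc
      simp [hH, Ne.symm hc]
    · simp
  · by_cases hI : a ∈ I
    · simp only [hH, hI, true_and, if_false, if_true, ite_mul, zero_mul]
      rw [Finset.sum_ite_mem, Finset.univ_inter]
    · simp [hH, hI]

/-- `P [I; G]` has spectral norm at most `√(1 + r²s²)`: the Frobenius norm of `G` is at most
`s √(k (n - k))` if `n ≤ 2r` is the number of rows and `k` the number of selected rows, and
`k (n - k) ≤ (n / 2)²`. -/
theorem frobNorm_interp_mul_le {r s : ℝ} {I H : Finset ι} (hHI : H ⊆ I) {G : Matrix ι ι 𝕜}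
    (hG : ∀ a ∈ I, a ∉ H → ∀ c ∈ H, ‖G a c‖ ≤ s) (hI : (I.card : ℝ) ≤ 2 * r)
    (X : Matrix ι ι' 𝕜) :
    frobNorm (interp I H G * X) ≤ interpBound r s * frobNorm (proj 𝕜 H * X) := by
  classical
  refine abs_le_of_sq_le_sq' ?_ (mul_nonneg (interpBound_nonneg _ _) (frobNorm_nonneg _)) |>.2
  set F := ∑ b, ∑ c ∈ H, ‖X c b‖ ^ 2 with hF
  have hF0 : 0 ≤ F := by positivity
  have hproj : frobNorm (proj 𝕜 H * X) ^ 2 = F := by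
    rw [frobNorm_sq, Finset.sum_comm, hF]
    refine Finset.sum_congr rfl fun b _ => ?_
    rw [← Finset.univ_inter H, ← Finset.sum_ite_mem]
    refine Finset.sum_congr rfl fun a _ => ?_
    rw [proj_mul_apply]
    simp only [Finset.univ_inter]
    split_ifs <;> simp
  have hentry : ∀ a b, ‖(interp I H G * X) a b‖ ^ 2 ≤ (if a ∈ H then ‖X a b‖ ^ 2 else 0) +
      (if a ∈ I \ H then s ^ 2 * H.card * ∑ c ∈ H, ‖X c b‖ ^ 2 else 0) := fun a b => by
    rw [interp_mul_apply hHI]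
    by_cases hH : a ∈ H
    · simp [hH]
    · by_cases haI : a ∈ I
      · simp only [hH, haI, if_false, if_true, Finset.mem_sdiff, not_false_eq_true, and_self,
          zero_add]
        calc ‖∑ c ∈ H, G a c * X c b‖ ^ 2 ≤ (∑ c ∈ H, ‖G a c‖ * ‖X c b‖) ^ 2 := by
              gcongr
              exact (norm_sum_le _ _).trans_eq (Finset.sum_congr rfl fun c _ => norm_mul _ _)
          _ ≤ (∑ c ∈ H, ‖G a c‖ ^ 2) * ∑ c ∈ H, ‖X c b‖ ^ 2 :=
              Finset.sum_mul_sq_le_sq_mul_sq _ _ _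
          _ ≤ (∑ c ∈ H, s ^ 2) * ∑ c ∈ H, ‖X c b‖ ^ 2 := by
              gcongr with c hc
              exact hG a haI hH c hc
          _ = _ := by simp [mul_comm]
      · simp [hH, haI]
  have hcard : ((I \ H).card : ℝ) * H.card ≤ r ^ 2 := by
    have h1 : ((I \ H).card : ℝ) + H.card ≤ 2 * r := by
      refine le_trans (le_of_eq ?_) hI
      exact_mod_cast Finset.card_sdiff_add_card_eq_card hHI
    nlinarith [sq_nonneg (((I \ H).card : ℝ) - H.card), Nat.cast_nonneg (α := ℝ) (I \ H).card,
      Nat.cast_nonneg (α := ℝ) H.card]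
  rw [mul_pow, hproj, interpBound_sq, frobNorm_sq]
  calc ∑ a, ∑ b, ‖(interp I H G * X) a b‖ ^ 2
      ≤ ∑ a, ∑ b, ((if a ∈ H then ‖X a b‖ ^ 2 else 0) +
          (if a ∈ I \ H then s ^ 2 * H.card * ∑ c ∈ H, ‖X c b‖ ^ 2 else 0)) := by
        gcongr with a _ b _
        exact hentry a b
    _ = F + ((I \ H).card * H.card) * s ^ 2 * F := by
        rw [Finset.sum_comm, hF, Finset.mul_sum, ← Finset.sum_add_distrib]
        refine Finset.sum_congr rfl fun b _ => ?_
        rw [Finset.sum_add_distrib, Finset.sum_ite_mem, Finset.sum_ite_mem, Finset.univ_inter,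
          Finset.univ_inter, Finset.sum_const, nsmul_eq_mul]
        ring
    _ ≤ F + r ^ 2 * s ^ 2 * F := by gcongr
    _ = _ := by ring

theorem frobNorm_interp_mul_le_proj {r s : ℝ} {I H : Finset ι} (hHI : H ⊆ I) {G : Matrix ι ι 𝕜}
    (hG : ∀ a ∈ I, a ∉ H → ∀ c ∈ H, ‖G a c‖ ≤ s) (hI : (I.card : ℝ) ≤ 2 * r)
    (X : Matrix ι ι' 𝕜) :
    frobNorm (interp I H G * X) ≤ interpBound r s * frobNorm (proj 𝕜 I * X) :=
  (frobNorm_interp_mul_le hHI hG hI X).trans <|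
    mul_le_mul_of_nonneg_left (frobNorm_proj_mul_le_of_subset hHI X) (interpBound_nonneg _ _)

theorem frobNorm_proj_sub_interp_mul_le {r s : ℝ} {I H : Finset ι} (hHI : H ⊆ I)
    {G : Matrix ι ι 𝕜} (hG : ∀ a ∈ I, a ∉ H → ∀ c ∈ H, ‖G a c‖ ≤ s)
    (hI : (I.card : ℝ) ≤ 2 * r) (X : Matrix ι ι' 𝕜) :
    frobNorm ((proj 𝕜 I - interp I H G) * X) ≤
      (1 + interpBound r s) * frobNorm (proj 𝕜 I * X) := by
  rw [Matrix.sub_mul]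
  have := frobNorm_sub_le (proj 𝕜 I * X) (interp I H G * X)
  have := frobNorm_interp_mul_le_proj hHI hG hI X
  linarith

/-- Matrices whose columns, restricted to the rows `I`, lie in the span of the compressed basis are
reproduced exactly from the selected rows. -/
theorem IsCompr.interp_mul {γ : Type*} [Fintype γ] {s : ℝ} {I H : Finset ι} {K : Matrix I γ 𝕜}
    {G : Matrix ι ι 𝕜} (h : IsCompr s I H K G) {M : Matrix ι δ 𝕜} (N : Matrix γ δ 𝕜)
    (hM : ∀ (a : I) (b : δ), M a b = (K * N) a b) :
    interp I H G * M = proj 𝕜 I * M := by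
  classical
  have hK : K * N = block (interp I H G) I H *
      (K * N).submatrix (fun c : H => (⟨c, h.subset c.2⟩ : I)) id := by
    conv_lhs => rw [h.factor, Matrix.mul_assoc]
    rfl
  ext a b
  rw [proj_mul_apply]
  by_cases ha : a ∈ I
  · rw [if_pos ha, hM ⟨a, ha⟩, hK, Matrix.mul_apply, Matrix.mul_apply]
    rw [← Finset.sum_subset (Finset.subset_univ H), ← Finset.sum_coe_sort H]
    · refine Finset.sum_congr rfl fun c _ => ?_
      have := hM ⟨c, h.subset c.2⟩ b
      simp only at this
      rw [this]
      rfl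
    · intro c _ hc
      simp [interp, hc]
  · rw [if_neg ha, Matrix.mul_apply]
    simp [interp, ha]

end Interpolation

/-! ### One node of the construction -/

section Node

variable {𝕜 ι ι' : Type*} [RCLike 𝕜] [Fintype ι] [Fintype ι'] {s ε : ℝ} {A : Matrix ι ι' 𝕜}
  {N : Set (List Bool)} {I : Finset ι} {J : List Bool → Finset ι'} {D : BasisData 𝕜 ι}
  {w : List Bool}

theorem NodeStep.hat_subset (h : NodeStep s ε A N I J D w) : D.hat w ⊆ I := by
  obtain ⟨_, _, _, _, _, _, h⟩ := h
  exact h.subset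

theorem NodeStep.norm_le (h : NodeStep s ε A N I J D w) :
    ∀ a ∈ I, a ∉ D.hat w → ∀ c ∈ D.hat w, ‖D.G w a c‖ ≤ s := by
  obtain ⟨_, _, _, _, _, _, h⟩ := h
  exact h.bound

theorem NodeStep.interp_mul_far (h : NodeStep s ε A N I J D w) :
    interp I (D.hat w) (D.G w) * D.far w = proj 𝕜 I * D.far w := by
  obtain ⟨k, S, σ, W, _, _, h⟩ := h
  refine h.interp_mul (Matrix.fromRows 1 0) fun a b => ?_
  rw [Matrix.fromCols_mul_fromRows, Matrix.mul_one, Matrix.mul_zero, add_zero]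
  rfl

/-- Replacing the rows of a nearfield block by their interpolants costs at most the truncation
error, amplified by the norm of the interpolation error. -/
theorem NodeStep.near_error {r : ℝ} (hε : 0 ≤ ε) (h : NodeStep s ε A N I J D w)
    (hI : (I.card : ℝ) ≤ 2 * r) {v : List Bool} (hv : v ∈ N) (hJ : ((J v).card : ℝ) ≤ 2 * r) :
    frobNorm ((proj 𝕜 I - interp I (D.hat w) (D.G w)) * A * proj 𝕜 (J v)) ≤
      (1 + interpBound r s) * (2 * r * ε * frobNorm (proj 𝕜 I * A)) := by
  classical
  have hsub := h.hat_subset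
  have hG := h.norm_le
  obtain ⟨k, S, σ, W, -, hnear, hcompr⟩ := h
  have hr : 0 ≤ 2 * r := le_trans (Nat.cast_nonneg _) hI
  -- the truncated block row, placed at its position in a matrix of full size
  let Z : Matrix (Fin k) ι' 𝕜 := fun t b =>
    if hb : b ∈ unionOver N J then (Matrix.diagonal (fun t => (σ t : 𝕜)) * W) t ⟨b, hb⟩ else 0
  let Y : Matrix ι ι' 𝕜 := fun a b => if ha : a ∈ I then (S * Z) ⟨a, ha⟩ b else 0
  have hY : (proj 𝕜 I - interp I (D.hat w) (D.G w)) * Y = 0 := by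
    rw [Matrix.sub_mul, sub_eq_zero]
    refine (hcompr.interp_mul (Matrix.fromRows 0 Z) fun a b => ?_).symm
    rw [Matrix.fromCols_mul_fromRows, Matrix.mul_zero, zero_add]
    simp [Y]
  have hJU : ∀ b ∈ J v, b ∈ unionOver N J := fun b hb => by
    simp only [unionOver, Finset.mem_filter, Finset.mem_univ, true_and]
    exact ⟨v, hv, hb⟩
  have hblock : frobNorm (block (A - Y) I (J v)) ≤
      2 * r * ε * frobNorm (proj 𝕜 I * A) := by
    have hspec : specNorm (block A I (unionOver N J)) ≤ frobNorm (proj 𝕜 I * A) :=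
      (specNorm_le_frobNorm _).trans <|
        (frobNorm_block _ _ _).trans_le (frobNorm_mul_proj_le _ _)
    have hsqrt : Real.sqrt ((I.card : ℝ) * ((J v).card : ℝ)) ≤ 2 * r := by
      rw [Real.sqrt_le_left hr, sq]
      gcongr
    have hs0 : 0 ≤ specNorm (block A I (unionOver N J)) := norm_nonneg _
    refine le_trans (le_of_eq ?_) ((hnear v hv).trans (by gcongr))
    unfold frobNorm
    congr 1
    refine Finset.sum_congr rfl fun a _ => ?_
    let e : J v ≃ {b : unionOver N J // (b : ι') ∈ J v} :=
      { toFun := fun b => ⟨⟨b, hJU b b.2⟩, b.2⟩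
        invFun := fun b => ⟨b.1.1, b.2⟩
        left_inv := fun _ => rfl
        right_inv := fun _ => rfl }
    refine Fintype.sum_equiv e _ _ fun b => ?_
    have hb := hJU b b.2
    have hZ : (S * Z) a b = (S * Matrix.diagonal (fun t => (σ t : 𝕜)) * W) a ⟨b, hb⟩ := by
      rw [Matrix.mul_assoc, Matrix.mul_apply, Matrix.mul_apply]
      refine Finset.sum_congr rfl fun t _ => ?_
      simp only [Z, dif_pos hb]
    have hYab : Y a b = (S * Z) a b := by simp [Y]
    simp only [block, Matrix.submatrix_apply, Matrix.sub_apply, id, hYab, hZ]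
    rfl
  have heq : (proj 𝕜 I - interp I (D.hat w) (D.G w)) * A * proj 𝕜 (J v) =
      (proj 𝕜 I - interp I (D.hat w) (D.G w)) * ((A - Y) * proj 𝕜 (J v)) := by
    rw [← Matrix.mul_assoc, Matrix.mul_sub, hY, sub_zero]
  rw [heq]
  refine (frobNorm_proj_sub_interp_mul_le hsub hG hI _).trans ?_
  have := interpBound_nonneg r s
  rw [← Matrix.mul_assoc, ← frobNorm_block]
  gcongr

end Node

/-! ### The levels of the tree -/

section Levels

/-- A word of length `k + 1` is a letter followed by a word of length `k`. -/
def consEquiv (k : ℕ) : Bool × List.Vector Bool k ≃ List.Vector Bool (k + 1) where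
  toFun p := p.1 ::ᵥ p.2
  invFun w := (w.head, w.tail)
  left_inv p := by simp
  right_inv w := by simp

theorem consEquiv_val (k : ℕ) (c : Bool) (w : List.Vector Bool k) :
    (consEquiv k (c, w)).1 = c :: w.1 := rfl

variable {𝕜 ι : Type*} [RCLike 𝕜]

/-- The properties of one side (rows or columns) of the construction that the error analysis uses:
the clusters of a level partition the indices, the intermediate and selected index sets are nested
in them, the interpolation coefficients are bounded by `s`, and the intermediate index sets have at
most `2r` elements. -/
structure IsSide (L : ℕ) (r s : ℝ) (full : List Bool → Finset ι) (D : BasisData 𝕜 ι) : Prop where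
  disj : ∀ w v a, w.length = v.length → w.length < L → a ∈ full w → a ∈ full v → w = v
  cover : ∀ k < L, ∀ a, ∃ w : List.Vector Bool k, a ∈ full w.1
  bar_subset : ∀ w, w.length < L → bar L full D.hat w ⊆ full w
  hat_subset : ∀ w, w ≠ [] → w.length < L → D.hat w ⊆ bar L full D.hat w
  norm_le : ∀ w, w ≠ [] → w.length < L → ∀ a ∈ bar L full D.hat w, a ∉ D.hat w →
    ∀ c ∈ D.hat w, ‖D.G w a c‖ ≤ s
  card_le : ∀ w, w ≠ [] → w.length < L → ((bar L full D.hat w).card : ℝ) ≤ 2 * r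

namespace IsSide

variable {L : ℕ} {r s : ℝ} {full : List Bool → Finset ι} {D : BasisData 𝕜 ι}

theorem full_disj (h : IsSide L r s full D) {k : ℕ} (hk : k < L) (w v : List.Vector Bool k) (a : ι)
    (hw : a ∈ full w.1) (hv : a ∈ full v.1) : w = v :=
  Subtype.ext (h.disj _ _ a (w.2.trans v.2.symm) (w.2.trans_lt hk) hw hv)

theorem bar_disj (h : IsSide L r s full D) {k : ℕ} (hk : k < L) (w v : List.Vector Bool k) (a : ι)
    (hw : a ∈ bar L full D.hat w.1) (hv : a ∈ bar L full D.hat v.1) : w = v :=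
  h.full_disj hk w v a (h.bar_subset _ (w.2.trans_lt hk) hw) (h.bar_subset _ (v.2.trans_lt hk) hv)

theorem ne_nil {k : ℕ} (hk : 1 ≤ k) (w : List.Vector Bool k) : w.1 ≠ [] := fun hc => by
  have := w.2
  rw [hc] at this
  simp at this
  omega

theorem hat_disj (h : IsSide L r s full D) {k : ℕ} (hk1 : 1 ≤ k) (hk : k < L)
    (w v : List.Vector Bool k) (a : ι) (hw : a ∈ D.hat w.1) (hv : a ∈ D.hat v.1) : w = v :=
  h.bar_disj hk w v a (h.hat_subset _ (ne_nil hk1 w) (w.2.trans_lt hk) hw)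
    (h.hat_subset _ (ne_nil hk1 v) (v.2.trans_lt hk) hv)

/-- The projection onto an intermediate index set of an inner node splits over the children. -/
theorem proj_bar (h : IsSide L r s full D) {k : ℕ} (hk : k + 1 < L) (w : List.Vector Bool k) :
    proj 𝕜 (bar L full D.hat w.1) = ∑ c : Bool, proj 𝕜 (D.hat (c :: w.1)) := by
  classical
  rw [bar, if_neg (by rw [w.2]; omega), proj_union, Fintype.sum_bool, add_comm]
  intro a h1 h2
  have := congrArg Subtype.val <| h.hat_disj (by omega) hk (consEquiv k (false, w))
    (consEquiv k (true, w)) a h1 h2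
  simp [consEquiv_val] at this

variable [Fintype ι]

theorem levelBasis_mul_proj_hat (h : IsSide L r s full D) {k : ℕ} (hk1 : 1 ≤ k) (hk : k < L)
    (w : List.Vector Bool k) :
    levelBasis L full D (k + 1) * proj 𝕜 (D.hat w.1) =
      interp (bar L full D.hat w.1) (D.hat w.1) (D.G w.1) := by
  classical
  change (∑ u : List.Vector Bool k, interp (bar L full D.hat u.1) (D.hat u.1) (D.G u.1)) * _ = _
  rw [Finset.sum_mul, Finset.sum_eq_single w, interp_mul_proj]
  · intro u _ hu
    ext a b
    rw [mul_proj_apply]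
    split_ifs with hb
    · have : b ∉ D.hat u.1 := fun hc => hu (h.hat_disj hk1 hk _ _ b hc hb)
      simp [interp, this]
    · rfl
  · simp

/-- The block diagonal matrix of a level inherits the norm bound of its blocks. -/
theorem frobNorm_levelBasis_mul_le {ι' : Type*} [Fintype ι'] (h : IsSide L r s full D) {k : ℕ}
    (hk1 : 1 ≤ k) (hk : k < L) (X : Matrix ι ι' 𝕜) :
    frobNorm (levelBasis L full D (k + 1) * X) ≤ interpBound r s * frobNorm X := by
  classical
  refine abs_le_of_sq_le_sq' ?_ (mul_nonneg (interpBound_nonneg _ _) (frobNorm_nonneg _)) |>.2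
  change frobNorm ((∑ u : List.Vector Bool k,
    interp (bar L full D.hat u.1) (D.hat u.1) (D.G u.1)) * X) ^ 2 ≤ _
  rw [Matrix.sum_mul, frobNorm_sum_sq]
  · calc ∑ u : List.Vector Bool k,
          frobNorm (interp (bar L full D.hat u.1) (D.hat u.1) (D.G u.1) * X) ^ 2
        ≤ ∑ u : List.Vector Bool k,
          (interpBound r s * frobNorm (proj 𝕜 (D.hat u.1) * X)) ^ 2 := by
          refine Finset.sum_le_sum fun u _ => pow_le_pow_left₀ (frobNorm_nonneg _) ?_ 2
          have h0 := ne_nil hk1 u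
          have h1 := u.2.trans_lt hk
          exact frobNorm_interp_mul_le (h.hat_subset _ h0 h1) (h.norm_le _ h0 h1)
            (h.card_le _ h0 h1) X
      _ ≤ (interpBound r s * frobNorm X) ^ 2 := by
          simp_rw [mul_pow]
          rw [← Finset.mul_sum]
          gcongr
          exact sum_frobNorm_proj_mul_sq_le _ (h.hat_disj hk1 hk) X
  · intro u v a b hu hv
    rw [← proj_mul_interp, Matrix.mul_assoc, proj_mul_apply] at hu hv
    exact h.bar_disj hk u v a (by by_contra hc; simp [hc] at hu) (by by_contra hc; simp [hc] at hv)

end IsSide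

end Levels

/-! ### Telescoping over the levels -/

section Telescoping

variable {𝕜 m n : Type*} [RCLike 𝕜]

open Classical in
/-- The part of `A` that lies in the off-diagonal blocks `I w × J v`, `w ≠ v`, over the words of
length `k`. -/
def offDiag (I : List Bool → Finset m) (J : List Bool → Finset n) (A : Matrix m n 𝕜) (k : ℕ) :
    Matrix m n 𝕜 :=
  ∑ p : List.Vector Bool k × List.Vector Bool k,
    if p.1 ≠ p.2 then pad (I p.1.1) (J p.2.1) A else 0

variable {L : ℕ} {r s : ℝ} {rowFull : List Bool → Finset m} {colFull : List Bool → Finset n}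
  {R : BasisData 𝕜 m} {C : BasisData 𝕜 n}

/-- At the leaves, the diagonal and the off-diagonal blocks make up the whole matrix. -/
theorem levelCoupling_add_offDiag_leaf (hR : IsSide L r s rowFull R) (hC : IsSide L r s colFull C)
    (A : Matrix m n 𝕜) {k : ℕ} (hk : k + 1 = L) :
    levelCoupling L A rowFull colFull R C (k + 1) +
      offDiag (bar L rowFull R.hat) (bar L colFull C.hat) A k = A := by
  classical
  ext a b
  obtain ⟨w, hw⟩ := hR.cover k (by omega) a
  obtain ⟨v, hv⟩ := hC.cover k (by omega) b
  have hw' : ∀ w' : List.Vector Bool k, a ∈ rowFull w'.1 ↔ w' = w := fun w' =>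
    ⟨fun h => hR.full_disj (by omega) _ _ a h hw, fun h => h ▸ hw⟩
  have hv' : ∀ v' : List.Vector Bool k, b ∈ colFull v'.1 ↔ v' = v := fun v' =>
    ⟨fun h => hC.full_disj (by omega) _ _ b h hv, fun h => h ▸ hv⟩
  have hbarR : ∀ w' : List.Vector Bool k, bar L rowFull R.hat w'.1 = rowFull w'.1 := fun w' =>
    if_pos (by rw [w'.2, hk])
  have hbarC : ∀ w' : List.Vector Bool k, bar L colFull C.hat w'.1 = colFull w'.1 := fun w' =>
    if_pos (by rw [w'.2, hk])
  have h1 : levelCoupling L A rowFull colFull R C (k + 1) a b = if w = v then A a b else 0 := by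
    rw [levelCoupling, if_pos hk, Matrix.sum_apply]
    change (∑ u : List.Vector Bool k, pad (rowFull u.1) (colFull u.1) A a b) = _
    simp only [pad, hw', hv']
    rw [Finset.sum_eq_single w]
    · simp
    · intro u _ hu
      simp [hu]
    · simp
  have h2 : offDiag (bar L rowFull R.hat) (bar L colFull C.hat) A k a b
      = if w ≠ v then A a b else 0 := by
    rw [offDiag, Matrix.sum_apply, Finset.sum_eq_single (w, v)]
    · split_ifs with h
      · simp only [pad, hbarR, hbarC, hw', hv']
        simp
      · rfl
    · intro p _ hp
      split_ifs with h
      · simp only [pad, hbarR, hbarC, hw', hv']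
        refine if_neg fun hc => hp (Prod.ext hc.1 hc.2)
      · rfl
    · simp
  rw [Matrix.add_apply, h1, h2]
  split_ifs <;> simp_all

variable [Fintype m] [Fintype n]

/-- The blocks of inner nodes split over their children: the couplings of siblings together with
the off-diagonal blocks of a level are the off-diagonal blocks of the level below. -/
theorem levelCoupling_add_offDiag (hR : IsSide L r s rowFull R) (hC : IsSide L r s colFull C)
    (A : Matrix m n 𝕜) {k : ℕ} (hk : k + 1 < L) :
    levelCoupling L A rowFull colFull R C (k + 1) +
      offDiag (bar L rowFull R.hat) (bar L colFull C.hat) A k = offDiag R.hat C.hat A (k + 1) := by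
  classical
  have hB : levelCoupling L A rowFull colFull R C (k + 1) =
      ∑ p : List.Vector Bool k × List.Vector Bool k,
        if p.1 = p.2 then ∑ c : Bool, pad (R.hat (c :: p.1.1)) (C.hat ((!c) :: p.2.1)) A else 0 := by
    rw [levelCoupling, if_neg (by omega), Fintype.sum_prod_type]
    refine Finset.sum_congr rfl fun w _ => ?_
    exact (Finset.sum_ite_eq Finset.univ w
      (fun v : List.Vector Bool k => ∑ c : Bool, pad (R.hat (c :: w.1)) (C.hat ((!c) :: v.1)) A)
      |>.trans (if_pos (Finset.mem_univ w))).symm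
  have hX : offDiag R.hat C.hat A (k + 1) =
      ∑ p : List.Vector Bool k × List.Vector Bool k, ∑ c : Bool, ∑ d : Bool,
        if (c, p.1) ≠ (d, p.2) then pad (R.hat (c :: p.1.1)) (C.hat (d :: p.2.1)) A else 0 := by
    rw [offDiag, ← ((consEquiv k).prodCongr (consEquiv k)).sum_comp]
    simp only [Fintype.sum_prod_type, Equiv.prodCongr_apply, Prod.map, ne_eq,
      EmbeddingLike.apply_eq_iff_eq, consEquiv_val]
    rw [Finset.sum_comm]
    refine Finset.sum_congr rfl fun w _ => ?_
    conv_rhs => rw [Finset.sum_comm]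
    refine Finset.sum_congr rfl fun c _ => ?_
    rw [Finset.sum_comm]
  rw [hB, hX, offDiag, ← Finset.sum_add_distrib]
  refine Finset.sum_congr rfl fun p _ => ?_
  obtain ⟨w, v⟩ := p
  by_cases hwv : w = v
  · subst hwv
    simp
  · simp only [hwv, if_false, ne_eq, not_false_eq_true, if_true, zero_add, Prod.mk.injEq, and_false]
    rw [pad_eq_proj, hR.proj_bar hk, hC.proj_bar hk, Matrix.sum_mul, Matrix.sum_mul]
    refine Finset.sum_congr rfl fun c _ => ?_
    rw [Matrix.mul_sum]
    exact Finset.sum_congr rfl fun d _ => (pad_eq_proj _ _ _).symm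

open Classical in
/-- The HSS representation of the off-diagonal blocks of one level: `A` is interpolated from the
selected rows and columns, block by block. -/
def offDiagApprox (L : ℕ) (rowFull : List Bool → Finset m) (colFull : List Bool → Finset n)
    (R : BasisData 𝕜 m) (C : BasisData 𝕜 n) (A : Matrix m n 𝕜) (k : ℕ) : Matrix m n 𝕜 :=
  ∑ p : List.Vector Bool k × List.Vector Bool k,
    if p.1 ≠ p.2 then
      interp (bar L rowFull R.hat p.1.1) (R.hat p.1.1) (R.G p.1.1) * A *
        (interp (bar L colFull C.hat p.2.1) (C.hat p.2.1) (C.G p.2.1))ᵀ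
    else 0

theorem levelBasis_mul_offDiag_mul (hR : IsSide L r s rowFull R) (hC : IsSide L r s colFull C)
    (A : Matrix m n 𝕜) {k : ℕ} (hk1 : 1 ≤ k) (hk : k < L) :
    levelBasis L rowFull R (k + 1) * offDiag R.hat C.hat A k *
      (levelBasis L colFull C (k + 1))ᵀ = offDiagApprox L rowFull colFull R C A k := by
  classical
  rw [offDiag, offDiagApprox, Matrix.mul_sum, Matrix.sum_mul]
  refine Finset.sum_congr rfl fun p _ => ?_
  split_ifs with h
  · rw [pad_eq_proj, ← hR.levelBasis_mul_proj_hat hk1 hk, ← hC.levelBasis_mul_proj_hat hk1 hk,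
      Matrix.transpose_mul, proj_transpose]
    simp only [Matrix.mul_assoc]
  · simp

/-- The error of the telescoping representation up to level `l = k + 1`, measured against the part
of `A` that this level has to represent. -/
def residual (L : ℕ) (rowFull : List Bool → Finset m) (colFull : List Bool → Finset n)
    (R : BasisData 𝕜 m) (C : BasisData 𝕜 n) (A : Matrix m n 𝕜) (k : ℕ) : Matrix m n 𝕜 :=
  levelCoupling L A rowFull colFull R C (k + 1) +
    offDiag (bar L rowFull R.hat) (bar L colFull C.hat) A k -
    telescope (levelBasis L rowFull R) (levelBasis L colFull C)
      (levelCoupling L A rowFull colFull R C) (k + 1)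

theorem residual_zero (A : Matrix m n 𝕜) : residual L rowFull colFull R C A 0 = 0 := by
  have : offDiag (bar L rowFull R.hat) (bar L colFull C.hat) A 0 = 0 := by
    refine Finset.sum_eq_zero fun p _ => if_neg ?_
    rw [not_not]
    exact Subtype.ext ((List.length_eq_zero_iff.1 p.1.2).trans
      (List.length_eq_zero_iff.1 p.2.2).symm)
  rw [residual, this, add_zero, zero_add, telescope, sub_self]

theorem residual_succ (hR : IsSide L r s rowFull R) (hC : IsSide L r s colFull C)
    (A : Matrix m n 𝕜) {k : ℕ} (hk : k + 1 < L) :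
    residual L rowFull colFull R C A (k + 1) =
      (offDiag (bar L rowFull R.hat) (bar L colFull C.hat) A (k + 1) -
        offDiagApprox L rowFull colFull R C A (k + 1)) +
      levelBasis L rowFull R (k + 2) * residual L rowFull colFull R C A k *
        (levelBasis L colFull C (k + 2))ᵀ := by
  rw [residual, residual, levelCoupling_add_offDiag hR hC A hk, Matrix.mul_sub, Matrix.sub_mul,
    levelBasis_mul_offDiag_mul hR hC A (by omega) hk, telescope]
  abel

end Telescoping

/-! ### The error of one level -/

section LevelError

variable {𝕜 m n : Type*} [RCLike 𝕜] [Fintype m] [Fintype n]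

theorem frobNorm_interp_mul_interp_transpose_le {r s : ℝ} {I H : Finset m} {I' H' : Finset n}
    (hHI : H ⊆ I) {G : Matrix m m 𝕜} (hG : ∀ a ∈ I, a ∉ H → ∀ c ∈ H, ‖G a c‖ ≤ s)
    (hI : (I.card : ℝ) ≤ 2 * r) (hHI' : H' ⊆ I') {G' : Matrix n n 𝕜}
    (hG' : ∀ a ∈ I', a ∉ H' → ∀ c ∈ H', ‖G' a c‖ ≤ s) (hI' : (I'.card : ℝ) ≤ 2 * r)
    (X : Matrix m n 𝕜) :
    frobNorm (interp I H G * X * (interp I' H' G')ᵀ) ≤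
      interpBound r s ^ 2 * frobNorm (proj 𝕜 I * X * proj 𝕜 I') := by
  have h1 := frobNorm_interp_mul_le_proj hHI hG hI (X * (interp I' H' G')ᵀ)
  have h2 := frobNorm_interp_mul_le_proj hHI' hG' hI' (proj 𝕜 I * X)ᵀ
  rw [← frobNorm_transpose, Matrix.transpose_mul, Matrix.transpose_transpose,
    ← frobNorm_transpose (proj 𝕜 I' * _), Matrix.transpose_mul (proj 𝕜 I'),
    Matrix.transpose_transpose, proj_transpose] at h2
  rw [← Matrix.mul_assoc, ← Matrix.mul_assoc] at h1
  calc _ ≤ _ := h1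
    _ ≤ interpBound r s * (interpBound r s * frobNorm (proj 𝕜 I * X * proj 𝕜 I')) :=
        mul_le_mul_of_nonneg_left h2 (interpBound_nonneg _ _)
    _ = _ := by ring

/-- A farfield block: a degenerate approximation `M` that both interpolations reproduce exactly is
as good as the interpolation, up to the norms of the interpolation operators. -/
theorem far_error {r s c : ℝ} {I H : Finset m} {I' H' : Finset n}
    (hHI : H ⊆ I) {G : Matrix m m 𝕜} (hG : ∀ a ∈ I, a ∉ H → ∀ c ∈ H, ‖G a c‖ ≤ s)
    (hI : (I.card : ℝ) ≤ 2 * r) (hHI' : H' ⊆ I') {G' : Matrix n n 𝕜}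
    (hG' : ∀ a ∈ I', a ∉ H' → ∀ c ∈ H', ‖G' a c‖ ≤ s) (hI' : (I'.card : ℝ) ≤ 2 * r)
    (A M : Matrix m n 𝕜) (hM : interp I H G * M * (interp I' H' G')ᵀ = proj 𝕜 I * M * proj 𝕜 I')
    (hc : 0 ≤ c) (hAM : ∀ a ∈ I, ∀ b ∈ I', ‖A a b - M a b‖ ≤ c) :
    frobNorm (pad I I' A - interp I H G * A * (interp I' H' G')ᵀ) ≤
      (1 + interpBound r s ^ 2) * (2 * r * c) := by
  have hr : 0 ≤ 2 * r := le_trans (Nat.cast_nonneg _) hI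
  have heq : pad I I' A - interp I H G * A * (interp I' H' G')ᵀ =
      proj 𝕜 I * (A - M) * proj 𝕜 I' - interp I H G * (A - M) * (interp I' H' G')ᵀ := by
    simp only [pad_eq_proj, Matrix.mul_sub, Matrix.sub_mul, hM]
    abel
  have h1 := frobNorm_interp_mul_interp_transpose_le hHI hG hI hHI' hG' hI' (A - M)
  have h2 : frobNorm (proj 𝕜 I * (A - M) * proj 𝕜 I') ≤ 2 * r * c := by
    refine (frobNorm_proj_mul_proj_le I I' (A - M) hc hAM).trans ?_
    gcongr
    rw [Real.sqrt_le_left hr, sq]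
    gcongr
  rw [heq]
  calc _ ≤ _ := frobNorm_sub_le _ _
    _ ≤ frobNorm (proj 𝕜 I * (A - M) * proj 𝕜 I') +
        interpBound r s ^ 2 * frobNorm (proj 𝕜 I * (A - M) * proj 𝕜 I') := by gcongr
    _ = (1 + interpBound r s ^ 2) * frobNorm (proj 𝕜 I * (A - M) * proj 𝕜 I') := by ring
    _ ≤ _ := by gcongr

/-- Bounds for blocks at pairwise disjoint positions give a bound for their sum. -/
theorem frobNorm_sum_blocks_le {P Q : Type*} [Fintype P] [Fintype Q] {I : P → Finset m}
    {J : Q → Finset n} (hI : ∀ p p' a, a ∈ I p → a ∈ I p' → p = p')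
    (hJ : ∀ q q' b, b ∈ J q → b ∈ J q' → q = q') (M : P × Q → Matrix m n 𝕜)
    (hM : ∀ p, M p = proj 𝕜 (I p.1) * M p * proj 𝕜 (J p.2)) {c S : ℝ} (hc : 0 ≤ c) (hS : 0 ≤ S)
    (g : P × Q → ℝ) (hg : ∀ p, frobNorm (M p) ≤ c * g p) (hgS : ∑ p, g p ^ 2 ≤ S ^ 2) :
    frobNorm (∑ p, M p) ≤ c * S := by
  classical
  refine abs_le_of_sq_le_sq' ?_ (mul_nonneg hc hS) |>.2
  rw [frobNorm_sum_sq]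
  · calc ∑ p, frobNorm (M p) ^ 2 ≤ ∑ p, (c * g p) ^ 2 :=
          Finset.sum_le_sum fun p _ => pow_le_pow_left₀ (frobNorm_nonneg _) (hg p) 2
      _ ≤ (c * S) ^ 2 := by
          simp_rw [mul_pow]
          rw [← Finset.mul_sum]
          gcongr
  · have key : ∀ p a b, M p a b ≠ 0 → a ∈ I p.1 ∧ b ∈ J p.2 := fun p a b h => by
      rw [hM, mul_proj_apply, proj_mul_apply] at h
      exact ⟨by_contra fun hc => h (by simp [hc]), by_contra fun hc => h (by simp [hc])⟩
    intro p p' a b h h'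
    exact Prod.ext (hI _ _ a (key _ _ _ h).1 (key _ _ _ h').1)
      (hJ _ _ b (key _ _ _ h).2 (key _ _ _ h').2)

variable {L : ℕ} {r s εSVD εfar : ℝ} {rowFull : List Bool → Finset m}
  {colFull : List Bool → Finset n} {R : BasisData 𝕜 m} {C : BasisData 𝕜 n}

/-- The error of one level. The `√(2^k)` stems from the nearfield, where each block is bounded by
the norm of a whole block row (or column), and a level has `2^k` of them; the farfield bounds are
blockwise relative and add up to the norm of `A`. -/
theorem frobNorm_offDiag_sub_le (hR : IsSide L r s rowFull R) (hC : IsSide L r s colFull C)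
    (A : Matrix m n 𝕜) {N : List Bool → Set (List Bool)} (hN : ∀ w v, v ∈ N w → w ∈ N v)
    (hr : 0 ≤ r) (hSVD : 0 ≤ εSVD) (hfar : 0 ≤ εfar)
    (hnearR : ∀ w v, w ≠ [] → w.length < L → v.length = w.length → v ∈ N w →
      frobNorm ((proj 𝕜 (bar L rowFull R.hat w) -
        interp (bar L rowFull R.hat w) (R.hat w) (R.G w)) * A * proj 𝕜 (bar L colFull C.hat v)) ≤
        (1 + interpBound r s) *
          (2 * r * εSVD * frobNorm (proj 𝕜 (bar L rowFull R.hat w) * A)))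
    (hnearC : ∀ w v, w ≠ [] → w.length < L → v.length = w.length → v ∈ N w →
      frobNorm ((proj 𝕜 (bar L colFull C.hat w) -
        interp (bar L colFull C.hat w) (C.hat w) (C.G w)) * Aᵀ * proj 𝕜 (bar L rowFull R.hat v)) ≤
        (1 + interpBound r s) *
          (2 * r * εSVD * frobNorm (proj 𝕜 (bar L colFull C.hat w) * Aᵀ)))
    (hfarfield : ∀ w v, w ≠ [] → w.length < L → v.length = w.length → v ≠ w → v ∉ N w →
      frobNorm (pad (bar L rowFull R.hat w) (bar L colFull C.hat v) A -
        interp (bar L rowFull R.hat w) (R.hat w) (R.G w) * A *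
          (interp (bar L colFull C.hat v) (C.hat v) (C.G v))ᵀ) ≤
        (1 + interpBound r s ^ 2) *
          (2 * r * (εfar * frobNorm (proj 𝕜 (rowFull w) * A * proj 𝕜 (colFull v)))))
    {k : ℕ} (hk1 : 1 ≤ k) (hk : k < L) :
    frobNorm (offDiag (bar L rowFull R.hat) (bar L colFull C.hat) A k -
        offDiagApprox L rowFull colFull R C A k) ≤
      2 * r * ((1 + interpBound r s) ^ 2 * (Real.sqrt (2 ^ k) * εSVD) +
        (1 + interpBound r s ^ 2) * εfar) * frobNorm A := by
  classical
  set q := interpBound r s with hq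
  have hq0 : 0 ≤ q := interpBound_nonneg r s
  let V := List.Vector Bool k
  let I : V → Finset m := fun w => bar L rowFull R.hat w.1
  let J : V → Finset n := fun w => bar L colFull C.hat w.1
  let PR : V → Matrix m m 𝕜 := fun w => interp (I w) (R.hat w.1) (R.G w.1)
  let PC : V → Matrix n n 𝕜 := fun w => interp (J w) (C.hat w.1) (C.G w.1)
  have hPR : ∀ w, proj 𝕜 (I w) * PR w = PR w := fun w => proj_mul_interp _ _ _
  have hPC : ∀ w, (PC w)ᵀ * proj 𝕜 (J w) = (PC w)ᵀ := fun w => by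
    rw [← proj_transpose (J w), ← Matrix.transpose_mul]
    exact congrArg Matrix.transpose (proj_mul_interp _ _ _)
  have hII : ∀ w, proj 𝕜 (I w) * proj 𝕜 (I w) = proj 𝕜 (I w) := fun w =>
    proj_mul_proj_of_subset subset_rfl
  have hJJ : ∀ w, proj 𝕜 (J w) * proj 𝕜 (J w) = proj 𝕜 (J w) := fun w =>
    proj_mul_proj_of_subset subset_rfl
  have hIdisj := hR.bar_disj hk
  have hJdisj := hC.bar_disj hk
  have hnil : ∀ w : V, w.1 ≠ [] := IsSide.ne_nil hk1
  have hlen : ∀ w : V, w.1.length < L := fun w => w.2.trans_lt hk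
  have hcard : (Fintype.card V : ℝ) = Real.sqrt (2 ^ k) ^ 2 := by
    rw [Real.sq_sqrt (by positivity)]
    simp [V]
  -- the interpolation errors of the rows and of the columns in the nearfield, and the farfield
  let near₁ : V × V → Matrix m n 𝕜 := fun p =>
    if p.1 ≠ p.2 ∧ p.2.1 ∈ N p.1.1 then (proj 𝕜 (I p.1) - PR p.1) * A * proj 𝕜 (J p.2) else 0
  let near₂ : V × V → Matrix m n 𝕜 := fun p =>
    if p.1 ≠ p.2 ∧ p.2.1 ∈ N p.1.1 then PR p.1 * A * (proj 𝕜 (J p.2) - (PC p.2)ᵀ) else 0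
  let far : V × V → Matrix m n 𝕜 := fun p =>
    if p.1 ≠ p.2 ∧ p.2.1 ∉ N p.1.1 then
      pad (I p.1) (J p.2) A - PR p.1 * A * (PC p.2)ᵀ else 0
  have hsplit : offDiag (bar L rowFull R.hat) (bar L colFull C.hat) A k -
      offDiagApprox L rowFull colFull R C A k = ∑ p, near₁ p + ∑ p, near₂ p + ∑ p, far p := by
    rw [offDiag, offDiagApprox, ← Finset.sum_sub_distrib, ← Finset.sum_add_distrib,
      ← Finset.sum_add_distrib]
    refine Finset.sum_congr rfl fun p _ => ?_
    by_cases h1 : p.1 = p.2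
    · simp [near₁, near₂, far, h1]
    · by_cases h2 : p.2.1 ∈ N p.1.1
      · simp only [near₁, near₂, far, h1, h2, ne_eq, not_false_eq_true, not_true_eq_false,
          if_true, and_self, and_false, if_false, add_zero, pad_eq_proj, Matrix.sub_mul,
          Matrix.mul_sub, I, J, PR, PC]
        abel
      · simp only [near₁, near₂, far, h1, h2, ne_eq, not_false_eq_true, if_true, and_self,
          and_false, if_false, zero_add, I, J, PR, PC]
  have hb1 : frobNorm (∑ p, near₁ p) ≤
      ((1 + q) * (2 * r * εSVD)) * (Real.sqrt (2 ^ k) * frobNorm A) := by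
    refine frobNorm_sum_blocks_le hIdisj hJdisj near₁ (fun p => ?_) (by positivity)
      (mul_nonneg (Real.sqrt_nonneg _) (frobNorm_nonneg _))
      (fun p => frobNorm (proj 𝕜 (I p.1) * A)) (fun p => ?_) ?_
    · simp only [near₁]
      split_ifs
      · simp only [Matrix.sub_mul, Matrix.mul_sub, ← Matrix.mul_assoc, I, J] at hII hPR ⊢
        simp only [hII, hPR]
        simp only [Matrix.mul_assoc]
        rw [hJJ]
      · simp
    · simp only [near₁]
      split_ifs with h
      · refine (hnearR _ _ (hnil _) (hlen _) (p.2.2.trans p.1.2.symm) h.2).trans_eq ?_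
        ring
      · rw [frobNorm_zero]
        exact mul_nonneg (by positivity) (frobNorm_nonneg _)
    · rw [Fintype.sum_prod_type_right]
      simp only [Finset.sum_const, Finset.card_univ, nsmul_eq_mul]
      rw [hcard, mul_pow]
      exact mul_le_mul_of_nonneg_left (sum_frobNorm_proj_mul_sq_le I hIdisj A) (by positivity)
  have hb2 : frobNorm (∑ p, near₂ p) ≤
      (q * ((1 + q) * (2 * r * εSVD))) * (Real.sqrt (2 ^ k) * frobNorm A) := by
    refine frobNorm_sum_blocks_le hIdisj hJdisj near₂ (fun p => ?_) (by positivity)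
      (mul_nonneg (Real.sqrt_nonneg _) (frobNorm_nonneg _))
      (fun p => frobNorm (proj 𝕜 (J p.2) * Aᵀ)) (fun p => ?_) ?_
    · simp only [near₂]
      split_ifs
      · rw [← Matrix.mul_assoc, ← Matrix.mul_assoc, hPR, Matrix.mul_assoc _ _ (proj 𝕜 (J p.2)),
          Matrix.sub_mul, hJJ, hPC]
      · simp
    · simp only [near₂]
      split_ifs with h
      · have h1 := frobNorm_interp_mul_le_proj (hR.hat_subset _ (hnil p.1) (hlen p.1))
          (hR.norm_le _ (hnil p.1) (hlen p.1)) (hR.card_le _ (hnil p.1) (hlen p.1))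
          (A * (proj 𝕜 (J p.2) - (PC p.2)ᵀ))
        have h2 := hnearC _ _ (hnil p.2) (hlen p.2) (p.1.2.trans p.2.2.symm) (hN _ _ h.2)
        rw [← frobNorm_transpose, Matrix.transpose_mul, Matrix.transpose_mul,
          Matrix.transpose_transpose, Matrix.transpose_sub, proj_transpose, proj_transpose] at h2
        rw [← Matrix.mul_assoc] at h1
        refine h1.trans ((mul_le_mul_of_nonneg_left h2 hq0).trans_eq ?_)
        ring
      · rw [frobNorm_zero]
        exact mul_nonneg (by positivity) (frobNorm_nonneg _)
    · rw [Fintype.sum_prod_type]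
      simp only [Finset.sum_const, Finset.card_univ, nsmul_eq_mul]
      rw [hcard, mul_pow, ← frobNorm_transpose A]
      exact mul_le_mul_of_nonneg_left (sum_frobNorm_proj_mul_sq_le J hJdisj Aᵀ) (by positivity)
  have hb3 : frobNorm (∑ p, far p) ≤ ((1 + q ^ 2) * (2 * r * εfar)) * frobNorm A := by
    refine frobNorm_sum_blocks_le hIdisj hJdisj far (fun p => ?_) (by positivity)
      (frobNorm_nonneg _)
      (fun p => frobNorm (proj 𝕜 (rowFull p.1.1) * A * proj 𝕜 (colFull p.2.1))) (fun p => ?_) ?_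
    · simp only [far]
      split_ifs
      · change _ = proj 𝕜 (I p.1) * _ * proj 𝕜 (J p.2)
        rw [Matrix.mul_sub, Matrix.sub_mul, pad_eq_proj]
        simp only [← Matrix.mul_assoc, hII, hPR]
        simp only [Matrix.mul_assoc, hJJ, hPC]
      · simp
    · simp only [far]
      split_ifs with h
      · refine (hfarfield _ _ (hnil _) (hlen _) (p.2.2.trans p.1.2.symm)
          (fun hc => h.1 (Subtype.ext hc.symm)) h.2).trans_eq ?_
        ring
      · rw [frobNorm_zero]
        exact mul_nonneg (by positivity) (frobNorm_nonneg _)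
    · rw [Fintype.sum_prod_type]
      refine (Finset.sum_le_sum fun w _ => ?_).trans
        (sum_frobNorm_proj_mul_sq_le (fun w : V => rowFull w.1) (hR.full_disj hk) A)
      rw [← frobNorm_transpose (_ * A)]
      refine le_trans (le_of_eq (Finset.sum_congr rfl fun v _ => ?_))
        (sum_frobNorm_proj_mul_sq_le (fun v : V => colFull v.1) (hC.full_disj hk) _)
      rw [← frobNorm_transpose, Matrix.transpose_mul, proj_transpose]
  rw [hsplit]
  calc _ ≤ frobNorm (∑ p, near₁ p) + frobNorm (∑ p, near₂ p) + frobNorm (∑ p, far p) :=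
        (frobNorm_add_le _ _).trans (by gcongr; exact frobNorm_add_le _ _)
    _ ≤ _ := add_le_add (add_le_add hb1 hb2) hb3
    _ = _ := by ring

/-- Accumulation over the levels: passing to the next level amplifies the residual by at most
`1 + r²s² ≤ 5/8 · 2r²s²`, which leaves `3/8` of the growth for the error of the new level. -/
theorem frobNorm_residual_le (hR : IsSide L r s rowFull R) (hC : IsSide L r s colFull C)
    (A : Matrix m n 𝕜) (hr : 2 ≤ r) (hs : 1 < s) (hSVD : 0 ≤ εSVD) (hfar : 0 ≤ εfar)
    (hlevel : ∀ k, 1 ≤ k → k < L →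
      frobNorm (offDiag (bar L rowFull R.hat) (bar L colFull C.hat) A k -
        offDiagApprox L rowFull colFull R C A k) ≤
      2 * r * ((1 + interpBound r s) ^ 2 * (Real.sqrt (2 ^ k) * εSVD) +
        (1 + interpBound r s ^ 2) * εfar) * frobNorm A)
    (k : ℕ) (hk : k < L) :
    frobNorm (residual L rowFull colFull R C A k) ≤
      (2 * r ^ 2 * s ^ 2) ^ (k + 1) * (16 * εSVD + 8 * εfar) * frobNorm A := by
  have hF := frobNorm_nonneg A
  induction k with
  | zero =>
    rw [residual_zero, frobNorm_zero]
    positivity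
  | succ k ih =>
    have hk1 : 1 ≤ k + 1 := by omega
    set q := interpBound r s with hq
    have hq0 : 0 ≤ q := interpBound_nonneg r s
    have hqsq : q ^ 2 = 1 + r ^ 2 * s ^ 2 := interpBound_sq r s
    set X := residual L rowFull colFull R C A k with hX
    have hUV : frobNorm (levelBasis L rowFull R (k + 2) * X * (levelBasis L colFull C (k + 2))ᵀ) ≤
        q ^ 2 * frobNorm X := by
      have h1 := hR.frobNorm_levelBasis_mul_le hk1 hk (X * (levelBasis L colFull C (k + 2))ᵀ)
      have h2 := hC.frobNorm_levelBasis_mul_le hk1 hk Xᵀ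
      rw [← frobNorm_transpose, Matrix.transpose_mul, Matrix.transpose_transpose,
        frobNorm_transpose X] at h2
      rw [← Matrix.mul_assoc] at h1
      refine h1.trans ((mul_le_mul_of_nonneg_left h2 hq0).trans_eq ?_)
      ring
    have hlev := hlevel (k + 1) hk1 hk
    have hX := ih (by omega)
    have hX0 := frobNorm_nonneg X
    set ρ := r ^ 2 * s ^ 2 with hρ
    have hρr : r ^ 2 ≤ ρ := le_mul_of_one_le_right (by positivity) (one_le_pow₀ hs.le)
    have hρ4 : 4 ≤ ρ := by nlinarith
    have h2r : 2 * r ≤ ρ := by nlinarith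
    have hq1 : (1 + q) ^ 2 ≤ 3 * ρ := by nlinarith
    have hq2 : 1 + q ^ 2 ≤ 2 * ρ := by linarith
    have hq3 : q ^ 2 ≤ 5 / 4 * ρ := by linarith
    have hsqrt : Real.sqrt (2 ^ (k + 1)) ≤ 2 ^ (k + 1) := by
      rw [Real.sqrt_le_left (by positivity)]
      exact le_self_pow₀ (one_le_pow₀ (by norm_num)) (by norm_num)
    have h2ρ : 2 * r ^ 2 * s ^ 2 = 2 * ρ := by rw [hρ]; ring
    rw [h2ρ] at hX ⊢
    have hpow : ρ ^ 2 * 2 ^ (k + 2) ≤ (2 * ρ) ^ (k + 1 + 1) := by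
      rw [mul_pow 2 ρ, mul_comm (2 ^ (k + 1 + 1))]
      exact mul_le_mul_of_nonneg_right (pow_le_pow_right₀ (by linarith) (by omega)) (by positivity)
    have h1pow : (1 : ℝ) ≤ 2 ^ (k + 2) := one_le_pow₀ (by norm_num)
    set F := frobNorm A with hFdef
    rw [residual_succ hR hC A hk]
    calc _ ≤ _ := frobNorm_add_le _ _
      _ ≤ 2 * r * ((1 + q) ^ 2 * (Real.sqrt (2 ^ (k + 1)) * εSVD) + (1 + q ^ 2) * εfar) * F +
          q ^ 2 * frobNorm X := add_le_add hlev hUV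
      _ ≤ ρ * ((3 * ρ) * (2 ^ (k + 1) * εSVD) + (2 * ρ) * εfar) * F +
          (5 / 4 * ρ) * ((2 * ρ) ^ (k + 1) * (16 * εSVD + 8 * εfar) * F) := by gcongr
      _ = (3 / 2 * (ρ ^ 2 * 2 ^ (k + 2)) * εSVD + 2 * (ρ ^ 2 * 1) * εfar) * F +
          5 / 8 * (2 * ρ) ^ (k + 1 + 1) * (16 * εSVD + 8 * εfar) * F := by ring
      _ ≤ (3 / 2 * (2 * ρ) ^ (k + 1 + 1) * εSVD + 2 * (2 * ρ) ^ (k + 1 + 1) * εfar) * F +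
          5 / 8 * (2 * ρ) ^ (k + 1 + 1) * (16 * εSVD + 8 * εfar) * F := by
          have : ρ ^ 2 * 1 ≤ (2 * ρ) ^ (k + 1 + 1) :=
            (mul_le_mul_of_nonneg_left h1pow (by positivity)).trans hpow
          gcongr
      _ ≤ 3 / 8 * (2 * ρ) ^ (k + 1 + 1) * (16 * εSVD + 8 * εfar) * F +
          5 / 8 * (2 * ρ) ^ (k + 1 + 1) * (16 * εSVD + 8 * εfar) * F := by
          have : 0 ≤ (2 * ρ) ^ (k + 1 + 1) * εSVD := by positivity
          have : 0 ≤ (2 * ρ) ^ (k + 1 + 1) * εfar := by positivity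
          gcongr
          linarith
      _ = _ := by ring

end LevelError

/-! ### The two sides of the SMASH construction -/

section Sides

variable {𝕜 E ι : Type*} [RCLike 𝕜] [Fintype ι]

open Classical in
/-- The geometric conditions on the partitioning and the conditions on the compressions provide what
the error analysis needs. -/
theorem isSide_of_cluster {L : ℕ} {r s : ℝ} {dom : List Bool → Set E} {x : ι → E}
    {D : BasisData 𝕜 ι} (hroot : ∀ a, x a ∈ dom [])
    (hsub : ∀ (w : List Bool) (c : Bool), w.length + 1 < L → dom (c :: w) ⊆ dom w)
    (hchild : ∀ (w : List Bool) (a : ι), w.length + 1 < L → x a ∈ dom w →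
      Xor (x a ∈ dom (false :: w)) (x a ∈ dom (true :: w)))
    (hhat : ∀ w, w ≠ [] → w.length < L → D.hat w ⊆ bar L (cluster dom x) D.hat w)
    (hnorm : ∀ w, w ≠ [] → w.length < L → ∀ a ∈ bar L (cluster dom x) D.hat w, a ∉ D.hat w →
      ∀ c ∈ D.hat w, ‖D.G w a c‖ ≤ s)
    (hcard : ∀ w, w ≠ [] → w.length < L → ((D.hat w).card : ℝ) ≤ r)
    (hleaf : ∀ w, w ≠ [] → w.length + 1 = L → ((cluster dom x w).card : ℝ) ≤ 2 * r) :
    IsSide L r s (cluster dom x) D where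
  disj w := by
    induction w with
    | nil => exact fun v a hl _ _ _ => (List.length_eq_zero_iff.1 hl.symm).symm
    | cons c w ih =>
      intro v a hl hL hw hv
      obtain _ | ⟨d, v⟩ := v
      · simp at hl
      simp only [List.length_cons, Nat.add_right_cancel_iff] at hl hL
      simp only [cluster, Finset.mem_filter, Finset.mem_univ, true_and] at ih hw hv
      have hwv := ih v a hl (by omega) (hsub w c hL hw) (hsub v d (hl ▸ hL) hv)
      subst hwv
      have := hchild w a hL (hsub w c hL hw)
      cases c <;> cases d <;> simp_all [Xor]
  cover k := by
    intro hk a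
    simp only [cluster, Finset.mem_filter, Finset.mem_univ, true_and]
    induction k with
    | zero => exact ⟨List.Vector.nil, hroot a⟩
    | succ k ih =>
      obtain ⟨w, hw⟩ := ih (by omega)
      rcases hchild w.1 a (by rw [w.2]; exact hk) hw with h | h
      · exact ⟨consEquiv k (false, w), h.1⟩
      · exact ⟨consEquiv k (true, w), h.1⟩
  bar_subset w := by
    -- downward induction on the level of `w`
    obtain ⟨j, hj⟩ : ∃ j, j = L - w.length := ⟨_, rfl⟩
    induction j generalizing w with
    | zero => intro h; omega
    | succ j ih =>
      intro h
      rw [bar]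
      split_ifs with hl
      · exact subset_rfl
      · have key : ∀ c : Bool, D.hat (c :: w) ⊆ cluster dom x w := fun c a ha => by
          have hlen : (c :: w).length < L := by simp only [List.length_cons]; omega
          have := ih (c :: w) (by simp only [List.length_cons]; omega) hlen
            (hhat (c :: w) (by simp) hlen ha)
          simp only [cluster, Finset.mem_filter, Finset.mem_univ, true_and] at this ⊢
          exact hsub w c hlen this
        exact Finset.union_subset (key false) (key true)
  hat_subset := hhat
  norm_le := hnorm
  card_le w h0 hL := by
    rw [bar]
    split_ifs with hl
    · exact hleaf w h0 hl
    · have h1 := hcard (false :: w) (by simp) (by simp only [List.length_cons]; omega)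
      have h2 := hcard (true :: w) (by simp) (by simp only [List.length_cons]; omega)
      have h3 : ((D.hat (false :: w) ∪ D.hat (true :: w)).card : ℝ) ≤
          (D.hat (false :: w)).card + (D.hat (true :: w)).card := by
        exact_mod_cast Finset.card_union_le _ _
      linarith

theorem WellSeparated.symm {E : Type*} [MetricSpace E] {τ : ℝ} {S T : Set E}
    (h : WellSeparated τ S T) : WellSeparated τ T S := by
  obtain ⟨a, b, δa, δb, h1, h2, h3, h4, h5⟩ := h
  exact ⟨b, a, δb, δa, h2, h1, h4, h3, by rwa [add_comm, dist_comm]⟩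

theorem mem_nearNodes_symm {E : Type*} [MetricSpace E] {τ : ℝ} {dom : List Bool → Set E}
    (w v : List Bool) (h : v ∈ nearNodes τ dom w) : w ∈ nearNodes τ dom v :=
  ⟨h.1.symm, h.2.1.symm, fun hc => h.2.2 hc.symm⟩

end Sides

end SMASH

end

theorem corollary4p6 {𝕜 E m n : Type*} [RCLike 𝕜]
    [NormedAddCommGroup E] [InnerProductSpace ℝ E] [FiniteDimensional ℝ E]
    [Fintype m] [Fintype n]
    (κ : E → E → 𝕜) (x : m → E) (y : n → E)
    (L : ℕ) (hL : 1 ≤ L) (T : SMASH.Partition L x y)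
    (τ s εSVD εfar : ℝ) (hτ0 : 0 < τ) (hτ1 : τ < 1) (hs : 1 < s)
    (hSVD : 0 ≤ εSVD) (hfar : 0 ≤ εfar)
    (R : SMASH.BasisData 𝕜 m) (C : SMASH.BasisData 𝕜 n)
    (hrun : SMASH.IsSMASH κ T τ s εSVD εfar R C)
    -- the level constants: `rk l` is written `r^(l)` in the usual notation
    (rk : ℕ → ℝ)
    (hrow : ∀ w : List Bool, w ≠ [] → w.length < L → ((R.hat w).card : ℝ) ≤ rk (w.length + 1))
    (hcol : ∀ w : List Bool, w ≠ [] → w.length < L → ((C.hat w).card : ℝ) ≤ rk (w.length + 1))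
    (hmono : ∀ l, 2 ≤ l → l < L → rk (l + 1) ≤ rk l)
    (hrow_leaf : ∀ w : List Bool, w.length + 1 = L →
      ((SMASH.cluster T.dom x w).card : ℝ) ≤ 2 * rk L)
    (hcol_leaf : ∀ w : List Bool, w.length + 1 = L →
      ((SMASH.cluster T.dom y w).card : ℝ) ≤ 2 * rk L)
    (r : ℝ) (hr : 2 ≤ r) (hrk : ∀ l, 1 < l → l ≤ L → rk l ≤ r) :
    SMASH.frobNorm (SMASH.kernelMatrix κ x y - SMASH.hssApprox κ T R C)
      ≤ (2 * r ^ 2 * s ^ 2) ^ L * (16 * εSVD + 8 * εfar) *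
          SMASH.frobNorm (SMASH.kernelMatrix κ x y) := by
  open SMASH in
  have hpos : ∀ w : List Bool, w ≠ [] → 1 ≤ w.length := fun w hw =>
    List.length_pos_iff.2 hw
  have hR : IsSide L r s (cluster T.dom x) R := isSide_of_cluster T.row_root T.child_subset
    T.row_child (fun w h0 h => (hrun.row_step w h0 h).hat_subset)
    (fun w h0 h => (hrun.row_step w h0 h).norm_le)
    (fun w h0 h => (hrow w h0 h).trans (hrk _ (by have := hpos w h0; omega) h))
    (fun w h0 h => (hrow_leaf w h).trans
      (by have := hrk L (by have := hpos w h0; omega) le_rfl; linarith))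
  have hC : IsSide L r s (cluster T.dom y) C := isSide_of_cluster T.col_root T.child_subset
    T.col_child (fun w h0 h => (hrun.col_step w h0 h).hat_subset)
    (fun w h0 h => (hrun.col_step w h0 h).norm_le)
    (fun w h0 h => (hcol w h0 h).trans (hrk _ (by have := hpos w h0; omega) h))
    (fun w h0 h => (hcol_leaf w h).trans
      (by have := hrk L (by have := hpos w h0; omega) le_rfl; linarith))
  set A := kernelMatrix κ x y with hA
  obtain ⟨k, rfl⟩ : ∃ k, L = k + 1 := ⟨L - 1, by omega⟩
  have hres : A - hssApprox κ T R C =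
      SMASH.residual (k + 1) (cluster T.dom x) (cluster T.dom y) R C A k := by
    rw [SMASH.residual, levelCoupling_add_offDiag_leaf hR hC A rfl]
    rfl
  rw [hres]
  refine frobNorm_residual_le hR hC A hr hs hSVD hfar (fun j hj1 hj => ?_) k (by omega)
  refine frobNorm_offDiag_sub_le hR hC A (N := nearNodes τ T.dom) mem_nearNodes_symm
    (by linarith) hSVD hfar (fun w v h0 hl hlen hv => ?_) (fun w v h0 hl hlen hv => ?_)
    (fun w v h0 hl hlen hne hv => ?_) hj1 hj
  all_goals
    have hv0 : v ≠ [] := fun hc => by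
      have := hpos w h0
      simp [hc] at hlen
      omega
    have hvl : v.length < k + 1 := hlen.trans_lt hl
  · exact (hrun.row_step w h0 hl).near_error hSVD (hR.card_le w h0 hl) hv (hC.card_le v hv0 hvl)
  · exact (hrun.col_step w h0 hl).near_error hSVD (hC.card_le w h0 hl) hv (hR.card_le v hv0 hvl)
  · have hsep : WellSeparated τ (T.dom w) (T.dom v) := by
      by_contra hc
      exact hv ⟨hlen, hne, hc⟩
    obtain ⟨B, hB⟩ := hrun.farfield w v h0 hl hlen hsep
    have hfarR := (hrun.row_step w h0 hl).interp_mul_far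
    have hfarC := congrArg Matrix.transpose (hrun.col_step v hv0 hvl).interp_mul_far
    rw [Matrix.transpose_mul, Matrix.transpose_mul, proj_transpose] at hfarC
    refine far_error (hR.hat_subset w h0 hl) (hR.norm_le w h0 hl) (hR.card_le w h0 hl)
      (hC.hat_subset v hv0 hvl) (hC.norm_le v hv0 hvl) (hC.card_le v hv0 hvl) A
      (R.far w * B * (C.far v)ᵀ) ?_ (mul_nonneg hfar (frobNorm_nonneg _)) fun a ha b hb => ?_
    · simp only [← Matrix.mul_assoc, hfarR]
      simp only [Matrix.mul_assoc, hfarC]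
    · exact (hB a ha b hb).trans (mul_le_mul_of_nonneg_left (maxNorm_block_le _ _ _) hfar)
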